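/- Let $k$ be a field. A monomial algebra is $kQ/\langle Z\rangle$ with $Q$ a finite quiver and $Z$ a finite set of paths of length at least $2$, none a proper subpath of another; paths are composed from right to left, $\mathcal B$ is the basis of paths containing no element of $Z$ as a subpath, and $k(X/\!/\mathcal B)$ is the vector space with basis the pairs $x/\!/p$ with $x\in X$, $p\in\mathcal B$ parallel. For an arrow $a$ and a path $\gamma$ parallel to $a$, let $r^{a/\!/\gamma}$ be the sum of all paths in $\mathcal B$ obtained from the path $r$ by replacing one appearance of $a$ by $\gamma$. Put $$\delta^0\colon k(Q_0/\!/\mathcal B)\to k(Q_1/\!/\mathcal B),\quad \delta^0(e/\!/p)=\sum_{s(a)=e,\ ap\in\mathcal B}a/\!/ap-\sum_{t(a)=e,\ pa\in\mathcal B}a/\!/pa,$$ $$\delta^1\colon k(Q_1/\!/\mathcal B)\to k(Z/\!/\mathcal B),\quad \delta^1(a/\!/p)=\sum_{r\in Z}r/\!/r^{a/\!/p}.$$ $\operatorname{Ker}\delta^1$ is a Lie algebra under $[a/\!/\gamma,b/\!/\varepsilon]=b/\!/\varepsilon^{a/\!/\gamma}-a/\!/\gamma^{b/\!/\varepsilon}$;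 an element $x=\sum\lambda_{a/\!/p}\,a/\!/p$ of it corresponds to the derivation that vanishes on the vertices and sends each arrow $a$ to $\sum_p\lambda_{a/\!/p}\,p$. Let $\mathrm{HH}^1$ denote the Lie algebra of derivations modulo inner derivations. Let $A=kQ_A/\langle Z_A\rangle$ and $B=kQ_B/\langle Z_B\rangle$ be directed monomial algebras on the same vertices $1,\dots,n$, i.e. every arrow $i\to j$ of $Q_A$ or $Q_B$ satisfies $i<j$, and assume that the two endpoints of each arrow of $Q_A$ lie in the same connected component of $Q_B$ (for example, that $B$ is connected). Let $\Lambda=\Lambda(B,A^{\mathrm{op}})$ be the dual extension algebra: the monomial algebra on the same vertices whose arrows are those of $Q_B$ and of $Q_{A^{\mathrm{op}}}$ (disjoint union) and whose relations are those of $B$, those of $A^{\mathrm{op}}$ and all paths $\alpha\beta$ (first $\beta$, then $\alpha$) with $\alpha$ an arrow of $Q_B$ and $\beta$ an arrow of $Q_{A^{\mathrm{op}}}$. Let - $\mathcal J'$ be the set of elements of $\operatorname{Ker}\delta^1_\Lambda$ in the span of the $b/\!/p$ with $b$ an arrow of $Q_B$ and $p\in\mathcal B_\Lambda$ of the form $q_m\cdots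 q_1p_l\cdots p_1$ with $l,m\ge1$, $p_i$ arrows of $Q_B$ and $q_j$ arrows of $Q_{A^{\mathrm{op}}}$; - $\operatorname{Ker}\delta^1_{\Lambda|B}$ be the set of elements of $\operatorname{Ker}\delta^1_\Lambda$ that vanish on the arrows of $Q_B$, and $\mathcal J=\mathcal J'+\operatorname{Ker}\delta^1_{\Lambda|B}$; - $\mathcal I$ be the part of $\operatorname{Im}\delta^0_\Lambda$ of degree at least $2$, where $a/\!/p$ has degree the length of $p$. Then the sum $\mathcal J=\mathcal J'\oplus\operatorname{Ker}\delta^1_{\Lambda|B}$ is direct, $\mathcal J$ is a Lie ideal of $\operatorname{Ker}\delta^1_\Lambda$, $\mathcal I$ is contained in $\mathcal J$ and is a Lie ideal of it, and there is a short exact sequence of Lie algebras $$0\to\mathcal J/\mathcal I\to\mathrm{HH}^1(\Lambda)\to\mathrm{HH}^1(B)\to0,$$ in which the first map is induced by the inclusion $\mathcal J\subseteq\operatorname{Ker}\delta^1_\Lambda$ and the second by the projection $\operatorname{Ker}\delta^1_\Lambda\to\operatorname{Ker}\delta^1_B$ that keeps the terms $b/\!/p$ with $b$ an arrow and $p$ a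 path of $Q_B$ and drops all others. -/

import Mathlib

noncomputable section

open scoped Classical

universe u

/-! ### Quivers and paths -/

/-- A finite quiver with vertex set `Fin n`. -/
structure FinQuiver (n : ℕ) where
  Arr : Type u
  fintypeArr : Fintype Arr
  src : Arr → Fin n
  tgt : Arr → Fin n

attribute [instance] FinQuiver.fintypeArr

namespace FinQuiver

variable {n : ℕ}

/-- `Q.IsPath i l j`: the arrows in the list `l`, traversed from left to right, form a path
from `i` to `j`. -/
def IsPath (Q : FinQuiver.{u} n) : Fin n → List Q.Arr → Fin n → Prop
  | i, [], j => i = j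
  | i, a :: l, j => Q.src a = i ∧ Q.IsPath (Q.tgt a) l j

/-- Paths of a quiver, including the trivial ones. The arrows are listed in the order in which
they are traversed. -/
@[ext]
structure Path (Q : FinQuiver.{u} n) where
  source : Fin n
  target : Fin n
  arrows : List Q.Arr
  isPath : Q.IsPath source arrows target

/-- The trivial path at a vertex. -/
def Path.vertex (Q : FinQuiver.{u} n) (i : Fin n) : Q.Path := ⟨i, i, [], rfl⟩

/-- An arrow, as a path of length one. -/
def Path.arrow (Q : FinQuiver.{u} n) (a : Q.Arr) : Q.Path := ⟨Q.src a, Q.tgt a, [a], rfl, rfl⟩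

theorem isPath_append (Q : FinQuiver.{u} n) {l l' : List Q.Arr} {i j : Fin n} :
    Q.IsPath i (l ++ l') j ↔ ∃ m, Q.IsPath i l m ∧ Q.IsPath m l' j := by
  induction l generalizing i with
  | nil => simp [IsPath]
  | cons a l ih => simp [IsPath, ih, and_assoc]

theorem IsPath.target_unique {Q : FinQuiver.{u} n} {l : List Q.Arr} {i j j' : Fin n}
    (h : Q.IsPath i l j) (h' : Q.IsPath i l j') : j = j' := by
  induction l generalizing i with
  | nil => exact h.symm.trans h'
  | cons a l ih => exact ih h.2 h'.2

/-- Two vertices are linked if they lie in the same connected component of (the underlying graph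
of) the quiver. -/
def Linked (Q : FinQuiver.{u} n) : Fin n → Fin n → Prop :=
  Relation.EqvGen fun i j => ∃ a : Q.Arr, Q.src a = i ∧ Q.tgt a = j

/-- The quiver is numbered so that every arrow `i → j` satisfies `i < j`. -/
def IsDirected (Q : FinQuiver.{u} n) : Prop := ∀ a : Q.Arr, Q.src a < Q.tgt a

/-- The opposite quiver. -/
abbrev op (Q : FinQuiver.{u} n) : FinQuiver.{u} n where
  Arr := Q.Arr
  fintypeArr := Q.fintypeArr
  src := Q.tgt
  tgt := Q.src

theorem IsPath.op {Q : FinQuiver.{u} n} {l : List Q.Arr} {i j : Fin n} (h : Q.IsPath i l j) :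
    Q.op.IsPath j l.reverse i := by
  induction l generalizing i with
  | nil => exact h.symm
  | cons a l ih =>
    rw [List.reverse_cons]
    exact (isPath_append _).2 ⟨Q.tgt a, ih h.2, rfl, h.1⟩

/-- The reversed path, in the opposite quiver. -/
def Path.op {Q : FinQuiver.{u} n} (p : Q.Path) : Q.op.Path :=
  ⟨p.target, p.source, p.arrows.reverse, p.isPath.op⟩

/-- The quiver whose arrows are the disjoint union of the arrows of `Q` and of `R`. -/
abbrev union (Q R : FinQuiver.{u} n) : FinQuiver.{u} n where
  Arr := Q.Arr ⊕ R.Arr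
  fintypeArr := inferInstance
  src := Sum.elim Q.src R.src
  tgt := Sum.elim Q.tgt R.tgt

theorem IsPath.inl {Q : FinQuiver.{u} n} (R : FinQuiver.{u} n) {l : List Q.Arr} {i j : Fin n}
    (h : Q.IsPath i l j) : (Q.union R).IsPath i (l.map Sum.inl) j := by
  induction l generalizing i with
  | nil => exact h
  | cons a l ih => exact ⟨h.1, ih h.2⟩

theorem IsPath.inr {R : FinQuiver.{u} n} (Q : FinQuiver.{u} n) {l : List R.Arr} {i j : Fin n}
    (h : R.IsPath i l j) : (Q.union R).IsPath i (l.map Sum.inr) j := by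
  induction l generalizing i with
  | nil => exact h
  | cons a l ih => exact ⟨h.1, ih h.2⟩

/-- A path of `Q`, viewed in the union. -/
def Path.inl {Q : FinQuiver.{u} n} (R : FinQuiver.{u} n) (p : Q.Path) : (Q.union R).Path :=
  ⟨p.source, p.target, p.arrows.map Sum.inl, p.isPath.inl R⟩

/-- A path of `R`, viewed in the union. -/
def Path.inr {R : FinQuiver.{u} n} (Q : FinQuiver.{u} n) (p : R.Path) : (Q.union R).Path :=
  ⟨p.source, p.target, p.arrows.map Sum.inr, p.isPath.inr Q⟩

end FinQuiver

/-- A finite quiver together with a finite set `rel` of paths of length at least two, none of which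
is a proper subpath of another one. These data present the monomial algebra `kQ / ⟨rel⟩`. -/
structure MonomialQuiver (n : ℕ) extends FinQuiver.{u} n where
  rel : Set toFinQuiver.Path
  rel_finite : rel.Finite
  two_le_length : ∀ r ∈ rel, 2 ≤ r.arrows.length
  rel_minimal : ∀ r ∈ rel, ∀ s ∈ rel, r.arrows <:+: s.arrows → r = s

/-! ### The path algebra -/

section PathAlgebra

variable {n : ℕ} (k : Type*) [Field k] (Q : FinQuiver.{u} n)

/-- The path algebra `kQ`, as a vector space: it has the paths as a basis. -/
def PathAlg : Type _ := Q.Path →₀ k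

namespace PathAlg

instance : AddCommGroup (PathAlg k Q) := inferInstanceAs (AddCommGroup (Q.Path →₀ k))
instance : Module k (PathAlg k Q) := inferInstanceAs (Module k (Q.Path →₀ k))

variable {Q}

/-- A path as an element of the path algebra. -/
def of (p : Q.Path) : PathAlg k Q := Finsupp.single p (1 : k)

variable {k}

/-- The linear extension of a function on paths. -/
def lift {M : Type*} [AddCommGroup M] [Module k M] (f : Q.Path → M) : PathAlg k Q →ₗ[k] M :=
  Finsupp.linearCombination k f

theorem lift_of {M : Type*} [AddCommGroup M] [Module k M] (f : Q.Path → M) (p : Q.Path) :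
    lift f (of k p) = f p := by
  have h := Finsupp.linearCombination_single (R := k) (v := f) 1 p
  rw [one_smul] at h
  exact h

/-- Induction on the basis of paths. -/
theorem induction_paths {P : PathAlg k Q → Prop} (h0 : P 0)
    (hadd : ∀ x y, P x → P y → P (x + y)) (hsmul : ∀ (c : k) x, P x → P (c • x))
    (hof : ∀ p, P (of k p)) (x : PathAlg k Q) : P x := by
  refine Finsupp.induction_linear (motive := fun x : Q.Path →₀ k => P x) x h0 hadd ?_
  intro p c
  have h : (Finsupp.single p c : Q.Path →₀ k) = c • Finsupp.single p (1 : k) := by simp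
  rw [h]
  exact hsmul c _ (hof p)

variable (k Q)

/-- The list of arrows `l` as a path from `i` to `j`, and `0` if it is not such a path. -/
def pathOrZero (i : Fin n) (l : List Q.Arr) (j : Fin n) : PathAlg k Q :=
  if h : Q.IsPath i l j then of k ⟨i, j, l, h⟩ else 0

variable {Q}

/-- The product `p q` of two paths: first `q`, then `p`, and `0` if they cannot be composed. -/
def mulPath (p q : Q.Path) : PathAlg k Q :=
  if q.target = p.source then pathOrZero k Q q.source (q.arrows ++ p.arrows) p.target else 0

variable (Q)

/-- The bilinear extension of the product of paths. -/
def mulHom : PathAlg k Q →ₗ[k] PathAlg k Q →ₗ[k] PathAlg k Q :=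
  lift fun p => lift fun q => mulPath k p q

instance : Mul (PathAlg k Q) := ⟨fun x y => mulHom k Q x y⟩
instance : One (PathAlg k Q) := ⟨∑ i, of k (FinQuiver.Path.vertex Q i)⟩

variable {k Q}

theorem mul_def (x y : PathAlg k Q) : x * y = mulHom k Q x y := rfl

theorem one_def : (1 : PathAlg k Q) = ∑ i, of k (FinQuiver.Path.vertex Q i) := rfl

theorem of_mul_of (p q : Q.Path) : of k p * of k q = mulPath k p q := by
  rw [mul_def, mulHom, lift_of, lift_of]

theorem pathOrZero_of_isPath {i j : Fin n} {l : List Q.Arr} (h : Q.IsPath i l j) :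
    pathOrZero k Q i l j = of k (⟨i, j, l, h⟩ : Q.Path) := dif_pos h

theorem of_mul_of_comp {i j m : Fin n} {l l' : List Q.Arr} (h : Q.IsPath i l m)
    (h' : Q.IsPath m l' j) :
    of k (⟨m, j, l', h'⟩ : Q.Path) * of k (⟨i, m, l, h⟩ : Q.Path) =
      of k (⟨i, j, l ++ l', Q.isPath_append.2 ⟨m, h, h'⟩⟩ : Q.Path) := by
  rw [of_mul_of, mulPath, if_pos rfl, pathOrZero_of_isPath]

theorem of_mul_of_ne {p q : Q.Path} (h : q.target ≠ p.source) : of k p * of k q = 0 := by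
  rw [of_mul_of, mulPath, if_neg h]

theorem add_mul' (x y z : PathAlg k Q) : (x + y) * z = x * z + y * z := by
  simp only [mul_def, map_add, LinearMap.add_apply]
theorem mul_add' (x y z : PathAlg k Q) : x * (y + z) = x * y + x * z := by
  simp only [mul_def, map_add]
theorem zero_mul' (x : PathAlg k Q) : 0 * x = 0 := by
  simp only [mul_def, map_zero, LinearMap.zero_apply]
theorem mul_zero' (x : PathAlg k Q) : x * 0 = 0 := by
  simp only [mul_def, map_zero]
theorem smul_mul' (c : k) (x y : PathAlg k Q) : c • x * y = c • (x * y) := by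
  simp only [mul_def, map_smul, LinearMap.smul_apply]
theorem mul_smul' (c : k) (x y : PathAlg k Q) : x * c • y = c • (x * y) := by
  simp only [mul_def, map_smul]

theorem of_assoc (p q r : Q.Path) :
    of k p * of k q * of k r = of k p * (of k q * of k r) := by
  obtain ⟨i, j, l, h⟩ := p
  obtain ⟨i', j', l', h'⟩ := q
  obtain ⟨i'', j'', l'', h''⟩ := r
  by_cases h1 : j' = i <;> by_cases h2 : j'' = i'
  · subst h1 h2
    simp only [of_mul_of_comp, List.append_assoc]
  · subst h1
    rw [of_mul_of_comp, of_mul_of_ne h2, of_mul_of_ne h2, mul_zero']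
  · subst h2
    rw [of_mul_of_comp, of_mul_of_ne h1, of_mul_of_ne h1, zero_mul']
  · rw [of_mul_of_ne h1, of_mul_of_ne h2, mul_zero', zero_mul']

theorem one_mul' (x : PathAlg k Q) : 1 * x = x := by
  refine induction_paths (P := fun x => 1 * x = x) (mul_zero' _)
    (fun x y hx hy => by rw [mul_add', hx, hy]) (fun c x hx => by rw [mul_smul', hx])
    (fun p => ?_) x
  have h : (1 : PathAlg k Q) * of k p =
      ∑ i, of k (FinQuiver.Path.vertex Q i) * of k p := by
    simp only [mul_def, one_def, map_sum, LinearMap.sum_apply]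
  rw [h, Finset.sum_eq_single p.target]
  · obtain ⟨i, j, l, hp⟩ := p
    have := of_mul_of_comp (k := k) hp (show Q.IsPath j [] j from rfl)
    simp only [List.append_nil] at this
    exact this
  · intro i _ hi
    exact of_mul_of_ne (Ne.symm hi)
  · simp

theorem mul_one' (x : PathAlg k Q) : x * 1 = x := by
  refine induction_paths (P := fun x => x * 1 = x) (zero_mul' _)
    (fun x y hx hy => by rw [add_mul', hx, hy]) (fun c x hx => by rw [smul_mul', hx])
    (fun p => ?_) x
  have h : of k p * (1 : PathAlg k Q) =
      ∑ i, of k p * of k (FinQuiver.Path.vertex Q i) := by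
    simp only [mul_def, one_def, map_sum]
  rw [h, Finset.sum_eq_single p.source]
  · obtain ⟨i, j, l, hp⟩ := p
    exact of_mul_of_comp (k := k) (show Q.IsPath i [] i from rfl) hp
  · intro i _ hi
    exact of_mul_of_ne hi
  · simp

theorem mul_assoc' (x y z : PathAlg k Q) : x * y * z = x * (y * z) := by
  refine induction_paths (P := fun x => x * y * z = x * (y * z)) (by simp only [zero_mul'])
    (fun a b ha hb => by simp only [add_mul', ha, hb])
    (fun c a ha => by simp only [smul_mul', ha]) (fun p => ?_) x
  refine induction_paths (P := fun y => of k p * y * z = of k p * (y * z))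
    (by simp only [zero_mul', mul_zero'])
    (fun a b ha hb => by simp only [add_mul', mul_add', ha, hb])
    (fun c a ha => by simp only [smul_mul', mul_smul', ha]) (fun q => ?_) y
  refine induction_paths (P := fun z => of k p * of k q * z = of k p * (of k q * z))
    (by simp only [mul_zero'])
    (fun a b ha hb => by simp only [mul_add', ha, hb])
    (fun c a ha => by simp only [mul_smul', ha]) (fun r => ?_) z
  exact of_assoc p q r

instance : Ring (PathAlg k Q) :=
  { (inferInstance : AddCommGroup (PathAlg k Q)) with
    mul := (· * ·)
    one := 1
    mul_assoc := mul_assoc'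
    one_mul := one_mul'
    mul_one := mul_one'
    left_distrib := mul_add'
    right_distrib := add_mul'
    zero_mul := zero_mul'
    mul_zero := mul_zero' }

instance : Algebra k (PathAlg k Q) := Algebra.ofModule smul_mul' mul_smul'

end PathAlg

end PathAlgebra

/-! ### The first Hochschild cohomology of an algebra -/

section Hochschild

variable (k : Type*) [Field k] (A : Type*) [Ring A] [Algebra k A]

/-- The space of `k`-linear derivations of `A`. -/
def algDer : Submodule k (A →ₗ[k] A) where
  carrier := {D | ∀ x y, D (x * y) = D x * y + x * D y}
  add_mem' := by
    intro D E hD hE x y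
    simp only [LinearMap.add_apply, hD x y, hE x y, add_mul, mul_add]
    abel
  zero_mem' := by intro x y; simp
  smul_mem' := by
    intro c D hD x y
    simp only [LinearMap.smul_apply, hD x y, smul_add, smul_mul_assoc, mul_smul_comm]

variable {k A}

theorem algDer_leibniz (D : algDer k A) (x y : A) :
    D.1 (x * y) = D.1 x * y + x * D.1 y := D.2 x y

theorem algDer_commutator (D E : algDer k A) :
    D.1 ∘ₗ E.1 - E.1 ∘ₗ D.1 ∈ algDer k A := by
  intro x y
  simp only [LinearMap.sub_apply, LinearMap.comp_apply, algDer_leibniz, map_add]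
  noncomm_ring

/-- The commutator bracket on derivations. -/
instance : Bracket (algDer k A) (algDer k A) := ⟨fun D E => ⟨_, algDer_commutator D E⟩⟩

theorem algDer_lie_apply (D E : algDer k A) (x : A) :
    (⁅D, E⁆ : algDer k A).1 x = D.1 (E.1 x) - E.1 (D.1 x) := rfl

theorem algDer_ext {D E : algDer k A} (h : ∀ x, D.1 x = E.1 x) : D = E :=
  Subtype.ext (LinearMap.ext h)

theorem algDer_add_apply (D E : algDer k A) (x : A) : (D + E).1 x = D.1 x + E.1 x := rfl

theorem algDer_smul_apply (c : k) (D : algDer k A) (x : A) : (c • D).1 x = c • D.1 x := rfl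

instance : LieRing (algDer k A) where
  add_lie D E F := algDer_ext fun x => by
    simp only [algDer_lie_apply, algDer_add_apply, map_add]; abel
  lie_add D E F := algDer_ext fun x => by
    simp only [algDer_lie_apply, algDer_add_apply, map_add]; abel
  lie_self D := algDer_ext fun x => by
    simp only [algDer_lie_apply, sub_self]; rfl
  leibniz_lie D E F := algDer_ext fun x => by
    simp only [algDer_lie_apply, algDer_add_apply, map_sub]; abel

instance : LieAlgebra k (algDer k A) where
  lie_smul c D E := algDer_ext fun x => by
    simp only [algDer_lie_apply, algDer_smul_apply, map_smul, smul_sub]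

variable (k A)

/-- The Lie ideal of inner derivations `x ↦ c x - x c`. -/
def innDer : LieIdeal k (algDer k A) where
  carrier := {D | ∃ c : A, ∀ x, D.1 x = c * x - x * c}
  add_mem' := by
    rintro D E ⟨c, hc⟩ ⟨d, hd⟩
    refine ⟨c + d, fun x => ?_⟩
    rw [algDer_add_apply, hc, hd]; noncomm_ring
  zero_mem' := ⟨0, fun x => by simp⟩
  smul_mem' := by
    rintro r D ⟨c, hc⟩
    refine ⟨r • c, fun x => ?_⟩
    rw [algDer_smul_apply, hc, smul_sub, smul_mul_assoc, mul_smul_comm]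
  lie_mem := by
    rintro D E ⟨c, hc⟩
    refine ⟨D.1 c, fun x => ?_⟩
    rw [algDer_lie_apply, hc, hc, map_sub, algDer_leibniz, algDer_leibniz]; noncomm_ring

/-- The first Hochschild cohomology `HH¹(A)`, as a Lie algebra: 1-cocycles of the Hochschild complex
are derivations, 1-coboundaries are inner derivations, and the Gerstenhaber bracket is the
commutator. -/
abbrev HH1 : Type _ := algDer k A ⧸ innDer k A

end Hochschild

/-! ### Monomial algebras and the combinatorial complex -/

namespace MonomialQuiver

variable {n : ℕ} (k : Type*) [Field k] (Q : MonomialQuiver.{u} n)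

/-- The ideal of the path algebra generated by the relations. -/
def relIdeal : TwoSidedIdeal (PathAlg k Q.toFinQuiver) :=
  TwoSidedIdeal.span (PathAlg.of k '' Q.rel)

/-- The monomial algebra `kQ / ⟨rel⟩`. -/
abbrev Alg : Type _ := PathAlg k Q.toFinQuiver ⧸ (Q.relIdeal k).asIdeal

/-- The class of a path in the monomial algebra. -/
def cls (p : Q.Path) : Q.Alg k := Ideal.Quotient.mk _ (PathAlg.of k p)

variable {Q} in
/-- The path belongs to `ℬ`: it does not contain any relation as a subpath. -/
def IsBasic (p : Q.Path) : Prop := ∀ r ∈ Q.rel, ¬ r.arrows <:+: p.arrows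

/-- The space `k(Q₀//ℬ)`. -/
def C0 : Submodule k (Fin n × Q.Path →₀ k) :=
  Finsupp.supported k k {ep | IsBasic ep.2 ∧ ep.2.source = ep.1 ∧ ep.2.target = ep.1}

/-- The space `k(Q₁//ℬ)`; the pair `(a, p)` stands for `a//p`. -/
def C1 : Submodule k (Q.Arr × Q.Path →₀ k) :=
  Finsupp.supported k k
    {ap | IsBasic ap.2 ∧ ap.2.source = Q.src ap.1 ∧ ap.2.target = Q.tgt ap.1}

/-- The linear projection that keeps the paths in `ℬ` and kills all others. -/
def trunc : PathAlg k Q.toFinQuiver →ₗ[k] PathAlg k Q.toFinQuiver :=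
  PathAlg.lift fun p => if IsBasic p then PathAlg.of k p else 0

/-- The sum of all paths obtained from `r` by replacing one appearance of the arrow `a` by the
path `γ`. -/
def replaceAll (r : Q.Path) (a : Q.Arr) (γ : Q.Path) : PathAlg k Q.toFinQuiver :=
  ∑ i ∈ Finset.range r.arrows.length,
    if r.arrows[i]? = some a then
      PathAlg.pathOrZero k Q.toFinQuiver r.source
        (r.arrows.take i ++ γ.arrows ++ r.arrows.drop (i + 1)) r.target
    else 0

/-- The element `r^{a//γ}`: the sum of all paths in `ℬ` obtained from `r` by replacing one
appearance of the arrow `a` by the path `γ`. -/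
def replace (r : Q.Path) (a : Q.Arr) (γ : Q.Path) : PathAlg k Q.toFinQuiver :=
  Q.trunc k (Q.replaceAll k r a γ)

/-- For `x = ∑ λ_p p`, the element `t//x = ∑ λ_p t//p`. -/
def pair {T : Type*} (t : T) : PathAlg k Q.toFinQuiver →ₗ[k] (T × Q.Path →₀ k) :=
  PathAlg.lift fun p => Finsupp.single (t, p) 1

/-- The differential `δ⁰`, with
`δ⁰(e//p) = ∑_{s(a) = e, ap ∈ ℬ} a//ap - ∑_{t(a) = e, pa ∈ ℬ} a//pa`. -/
def delta0 : (Fin n × Q.Path →₀ k) →ₗ[k] (Q.Arr × Q.Path →₀ k) :=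
  Finsupp.linearCombination k fun ep =>
    (∑ a : Q.Arr, if Q.src a = ep.1 then
        Q.pair k a (Q.trunc k
          (PathAlg.pathOrZero k Q.toFinQuiver ep.2.source (ep.2.arrows ++ [a]) (Q.tgt a)))
      else 0) -
    ∑ a : Q.Arr, if Q.tgt a = ep.1 then
        Q.pair k a (Q.trunc k
          (PathAlg.pathOrZero k Q.toFinQuiver (Q.src a) (a :: ep.2.arrows) ep.2.target))
      else 0

/-- The differential `δ¹`, with `δ¹(a//p) = ∑_{r ∈ rel} r//r^{a//p}`. -/
def delta1 : (Q.Arr × Q.Path →₀ k) →ₗ[k] (Q.Path × Q.Path →₀ k) :=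
  Finsupp.linearCombination k fun ap =>
    ∑ r ∈ Q.rel_finite.toFinset, Q.pair k r (Q.replace k r ap.1 ap.2)

/-- `Im δ⁰`. -/
def imDelta0 : Submodule k (Q.Arr × Q.Path →₀ k) := (Q.C0 k).map (Q.delta0 k)

/-- `Ker δ¹`. -/
def kerDelta1 : Submodule k (Q.Arr × Q.Path →₀ k) := Q.C1 k ⊓ LinearMap.ker (Q.delta1 k)

/-- The bilinear bracket with `[a//γ, b//ε] = b//ε^{a//γ} - a//γ^{b//ε}`. -/
def br : (Q.Arr × Q.Path →₀ k) →ₗ[k] (Q.Arr × Q.Path →₀ k) →ₗ[k] (Q.Arr × Q.Path →₀ k) :=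
  Finsupp.linearCombination k fun aγ => Finsupp.linearCombination k fun bε =>
    Q.pair k bε.1 (Q.replace k bε.2 aγ.1 aγ.2) - Q.pair k aγ.1 (Q.replace k aγ.2 bε.1 bε.2)

/-- For `x = ∑ λ_{a//p} a//p`, the value `x(a) = ∑_p λ_{a//p} p`. -/
def val {T : Type*} (t : T) : (T × Q.Path →₀ k) →ₗ[k] PathAlg k Q.toFinQuiver :=
  Finsupp.linearCombination k fun bp => if bp.1 = t then PathAlg.of k bp.2 else 0

/-! ### The Lie algebra structure on `Ker δ¹` -/

/-- The linear endomorphism of the path algebra that replaces arrows `a` by `x(a)`. -/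
def subst : (Q.Arr × Q.Path →₀ k) →ₗ[k]
    PathAlg k Q.toFinQuiver →ₗ[k] PathAlg k Q.toFinQuiver :=
  Finsupp.linearCombination k fun aγ => PathAlg.lift fun r => Q.replaceAll k r aγ.1 aγ.2

variable {k Q}

theorem trunc_of (p : Q.Path) :
    Q.trunc k (PathAlg.of k p) = if IsBasic p then PathAlg.of k p else 0 := by
  rw [trunc, PathAlg.lift_of]

theorem pair_of {T : Type*} (t : T) (p : Q.Path) :
    Q.pair k t (PathAlg.of k p) = Finsupp.single (t, p) 1 := by
  rw [pair, PathAlg.lift_of]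

theorem val_single {T : Type*} (t u : T) (p : Q.Path) :
    Q.val k t (Finsupp.single (u, p) 1) = if u = t then PathAlg.of k p else 0 := by
  rw [val, Finsupp.linearCombination_single, one_smul]

theorem val_pair {T : Type*} (t u : T) (f : PathAlg k Q.toFinQuiver) :
    Q.val k t (Q.pair k u f) = if u = t then f else 0 := by
  refine PathAlg.induction_paths (P := fun f => Q.val k t (Q.pair k u f) = if u = t then f else 0)
    (by simp) (fun x y hx hy => ?_) (fun c x hx => ?_) (fun p => ?_) f
  · rw [map_add, map_add, hx, hy]; split_ifs <;> simp
  · rw [map_smul, map_smul, hx]; split_ifs <;> simp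
  · rw [pair_of, val_single]

theorem sum_pair_val (x : Q.Arr × Q.Path →₀ k) : ∑ a, Q.pair k a (Q.val k a x) = x := by
  induction x using Finsupp.induction_linear with
  | zero => simp
  | add x y hx hy => simp only [map_add, Finset.sum_add_distrib, hx, hy]
  | single bp c =>
    have h : (Finsupp.single bp c : Q.Arr × Q.Path →₀ k) = c • Finsupp.single (bp.1, bp.2) 1 := by
      simp
    rw [h]
    simp only [map_smul, ← Finset.smul_sum, val_single]
    rw [Finset.sum_eq_single bp.1]
    · simp [pair_of]
    · intro b _ hb
      rw [if_neg (Ne.symm hb), map_zero]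
    · simp

theorem val_ext {x y : Q.Arr × Q.Path →₀ k} (h : ∀ a, Q.val k a x = Q.val k a y) : x = y := by
  rw [← sum_pair_val x, ← sum_pair_val y]
  simp only [h]

/-- Bilinear extensionality on pairs. -/
theorem pairs_induction {P : (Q.Arr × Q.Path →₀ k) → Prop} (h0 : P 0)
    (hadd : ∀ x y, P x → P y → P (x + y)) (hsmul : ∀ (c : k) x, P x → P (c • x))
    (hs : ∀ a p, P (Finsupp.single (a, p) 1)) (x : Q.Arr × Q.Path →₀ k) : P x := by
  induction x using Finsupp.induction_linear with
  | zero => exact h0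
  | add x y hx hy => exact hadd x y hx hy
  | single bp c =>
    have h : (Finsupp.single bp c : Q.Arr × Q.Path →₀ k) = c • Finsupp.single (bp.1, bp.2) 1 := by
      simp
    rw [h]
    exact hsmul c _ (hs _ _)

theorem C1_induction {P : (Q.Arr × Q.Path →₀ k) → Prop} (h0 : P 0)
    (hadd : ∀ x y, P x → P y → P (x + y)) (hsmul : ∀ (c : k) x, P x → P (c • x))
    (hs : ∀ a p, IsBasic p → p.source = Q.src a → p.target = Q.tgt a →
      P (Finsupp.single (a, p) 1)) {x : Q.Arr × Q.Path →₀ k} (hx : x ∈ Q.C1 k) : P x := by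
  rw [C1, Finsupp.supported_eq_span_single] at hx
  refine Submodule.span_induction (p := fun x _ => P x) ?_ h0 (fun x y _ _ => hadd x y)
    (fun c x _ => hsmul c x) hx
  rintro _ ⟨⟨a, p⟩, ⟨h1, h2, h3⟩, rfl⟩
  exact hs a p h1 h2 h3

theorem subst_single_of (a : Q.Arr) (γ r : Q.Path) :
    Q.subst k (Finsupp.single (a, γ) 1) (PathAlg.of k r) = Q.replaceAll k r a γ := by
  rw [subst, Finsupp.linearCombination_single, one_smul, PathAlg.lift_of]

theorem br_single (a b : Q.Arr) (γ ε : Q.Path) :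
    Q.br k (Finsupp.single (a, γ) 1) (Finsupp.single (b, ε) 1) =
      Q.pair k b (Q.replace k ε a γ) - Q.pair k a (Q.replace k γ b ε) := by
  rw [br, Finsupp.linearCombination_single, one_smul, Finsupp.linearCombination_single, one_smul]

theorem val_br (c : Q.Arr) (x y : Q.Arr × Q.Path →₀ k) :
    Q.val k c (Q.br k x y) =
      Q.trunc k (Q.subst k x (Q.val k c y)) - Q.trunc k (Q.subst k y (Q.val k c x)) := by
  refine pairs_induction (P := fun x => Q.val k c (Q.br k x y) =
      Q.trunc k (Q.subst k x (Q.val k c y)) - Q.trunc k (Q.subst k y (Q.val k c x)))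
    (by simp) (fun x x' hx hx' => ?_) (fun r x hx => ?_) (fun a γ => ?_) x
  · simp only [map_add, LinearMap.add_apply, hx, hx']; abel
  · simp only [map_smul, LinearMap.smul_apply, hx, smul_sub]
  refine pairs_induction (P := fun y => Q.val k c (Q.br k (Finsupp.single (a, γ) 1) y) =
      Q.trunc k (Q.subst k (Finsupp.single (a, γ) 1) (Q.val k c y)) -
        Q.trunc k (Q.subst k y (Q.val k c (Finsupp.single (a, γ) 1))))
    (by simp) (fun x x' hx hx' => ?_) (fun r x hx => ?_) (fun b ε => ?_) y
  · simp only [map_add, LinearMap.add_apply, hx, hx']; abel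
  · simp only [map_smul, LinearMap.smul_apply, hx, smul_sub]
  rw [br_single, map_sub, val_pair, val_pair, val_single, val_single]
  congr 1 <;> split_ifs <;> simp only [subst_single_of, map_zero, replace]

theorem val_delta1 {r : Q.Path} (hr : r ∈ Q.rel) (x : Q.Arr × Q.Path →₀ k) :
    Q.val k r (Q.delta1 k x) = Q.trunc k (Q.subst k x (PathAlg.of k r)) := by
  refine pairs_induction (P := fun x => Q.val k r (Q.delta1 k x) =
      Q.trunc k (Q.subst k x (PathAlg.of k r)))
    (by simp) (fun x x' hx hx' => ?_) (fun r x hx => ?_) (fun a γ => ?_) x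
  · simp only [map_add, LinearMap.add_apply, hx, hx']
  · simp only [map_smul, LinearMap.smul_apply, hx]
  rw [delta1, Finsupp.linearCombination_single, one_smul, map_sum, subst_single_of]
  simp only [val_pair]
  rw [Finset.sum_ite_eq', if_pos (by simpa using hr), replace]

theorem trunc_trunc (f : PathAlg k Q.toFinQuiver) : Q.trunc k (Q.trunc k f) = Q.trunc k f := by
  refine PathAlg.induction_paths (P := fun f => Q.trunc k (Q.trunc k f) = Q.trunc k f)
    (by simp) (fun x y hx hy => by simp only [map_add, hx, hy])
    (fun c x hx => by simp only [map_smul, hx]) (fun p => ?_) f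
  rw [trunc_of]; split_ifs with h
  · rw [trunc_of, if_pos h]
  · rw [map_zero]

theorem trunc_mul_left (f g : PathAlg k Q.toFinQuiver) :
    Q.trunc k (Q.trunc k f * g) = Q.trunc k (f * g) := by
  refine PathAlg.induction_paths (P := fun f => Q.trunc k (Q.trunc k f * g) = Q.trunc k (f * g))
    (by simp) (fun x y hx hy => by simp only [map_add, add_mul, hx, hy])
    (fun c x hx => by simp only [map_smul, smul_mul_assoc, hx]) (fun p => ?_) f
  refine PathAlg.induction_paths
    (P := fun g => Q.trunc k (Q.trunc k (PathAlg.of k p) * g) = Q.trunc k (PathAlg.of k p * g))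
    (by simp) (fun x y hx hy => by simp only [map_add, mul_add, hx, hy])
    (fun c x hx => by simp only [map_smul, mul_smul_comm, hx]) (fun q => ?_) g
  rw [trunc_of]
  split_ifs with h
  · rfl
  · obtain ⟨i, j, l, hp⟩ := p
    obtain ⟨i', j', l', hq⟩ := q
    rw [zero_mul, map_zero]
    by_cases h1 : j' = i
    · subst h1
      rw [PathAlg.of_mul_of_comp, trunc_of, if_neg]
      intro hb
      refine h fun r hr hrl => hb r hr (hrl.trans ?_)
      exact (List.suffix_append _ _).isInfix
    · rw [PathAlg.of_mul_of_ne h1, map_zero]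

theorem trunc_mul_right (f g : PathAlg k Q.toFinQuiver) :
    Q.trunc k (f * Q.trunc k g) = Q.trunc k (f * g) := by
  refine PathAlg.induction_paths (P := fun f => Q.trunc k (f * Q.trunc k g) = Q.trunc k (f * g))
    (by simp) (fun x y hx hy => by simp only [map_add, add_mul, hx, hy])
    (fun c x hx => by simp only [map_smul, smul_mul_assoc, hx]) (fun p => ?_) f
  refine PathAlg.induction_paths
    (P := fun g => Q.trunc k (PathAlg.of k p * Q.trunc k g) = Q.trunc k (PathAlg.of k p * g))
    (by simp) (fun x y hx hy => by simp only [map_add, mul_add, hx, hy])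
    (fun c x hx => by simp only [map_smul, mul_smul_comm, hx]) (fun q => ?_) g
  rw [trunc_of]
  split_ifs with h
  · rfl
  · obtain ⟨i, j, l, hp⟩ := p
    obtain ⟨i', j', l', hq⟩ := q
    rw [mul_zero, map_zero]
    by_cases h1 : j' = i
    · subst h1
      rw [PathAlg.of_mul_of_comp, trunc_of, if_neg]
      intro hb
      refine h fun r hr hrl => hb r hr (hrl.trans ?_)
      exact (List.prefix_append _ _).isInfix
    · rw [PathAlg.of_mul_of_ne h1, map_zero]

theorem isPath_replace {Q : FinQuiver.{u} n} {s t : Fin n} {l γ : List Q.Arr} {a : Q.Arr} {i : ℕ}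
    (hl : Q.IsPath s l t) (hγ : Q.IsPath (Q.src a) γ (Q.tgt a)) (ha : l[i]? = some a) :
    Q.IsPath s (l.take i ++ γ ++ l.drop (i + 1)) t := by
  induction l generalizing s i with
  | nil => simp at ha
  | cons b l ih =>
    cases i with
    | zero =>
      simp only [List.getElem?_cons_zero, Option.some.injEq] at ha
      subst ha
      obtain ⟨rfl, h2⟩ := hl
      exact Q.isPath_append.2 ⟨_, Q.isPath_append.2 ⟨_, rfl, hγ⟩, h2⟩
    | succ i =>
      exact ⟨hl.1, ih hl.2 ha⟩

theorem pathOrZero_mul_of {i m m' j : Fin n} {l l' : List Q.Arr} (h : Q.IsPath i l m)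
    (h' : Q.IsPath m' l' j) :
    PathAlg.pathOrZero k Q.toFinQuiver m' l' j * PathAlg.of k ⟨i, m, l, h⟩ =
      if m = m' then PathAlg.pathOrZero k Q.toFinQuiver i (l ++ l') j else 0 := by
  rw [PathAlg.pathOrZero_of_isPath h']
  split_ifs with hm
  · subst hm
    rw [PathAlg.of_mul_of_comp, PathAlg.pathOrZero_of_isPath]
  · exact PathAlg.of_mul_of_ne hm

theorem of_mul_pathOrZero {i m m' j : Fin n} {l l' : List Q.Arr} (h : Q.IsPath i l m)
    (h' : Q.IsPath m' l' j) :
    PathAlg.of k ⟨m', j, l', h'⟩ * PathAlg.pathOrZero k Q.toFinQuiver i l m =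
      if m = m' then PathAlg.pathOrZero k Q.toFinQuiver i (l ++ l') j else 0 := by
  rw [PathAlg.pathOrZero_of_isPath h]
  split_ifs with hm
  · subst hm
    rw [PathAlg.of_mul_of_comp, PathAlg.pathOrZero_of_isPath]
  · exact PathAlg.of_mul_of_ne hm

theorem replaceAll_mul (p q : Q.Path) (a : Q.Arr) (γ : Q.Path) (h1 : γ.source = Q.src a)
    (h2 : γ.target = Q.tgt a) :
    Q.subst k (Finsupp.single (a, γ) 1) (PathAlg.of k p * PathAlg.of k q) =
      Q.replaceAll k p a γ * PathAlg.of k q + PathAlg.of k p * Q.replaceAll k q a γ := by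
  have hγ : Q.IsPath (Q.src a) γ.arrows (Q.tgt a) := by rw [← h1, ← h2]; exact γ.isPath
  obtain ⟨i, j, l, hp⟩ := p
  obtain ⟨i', j', l', hq⟩ := q
  have e1 : Q.replaceAll k ⟨i, j, l, hp⟩ a γ * PathAlg.of k ⟨i', j', l', hq⟩ =
      ∑ x ∈ Finset.range l.length, if l[x]? = some a then
        (if j' = i then PathAlg.pathOrZero k Q.toFinQuiver i'
          (l' ++ (l.take x ++ γ.arrows ++ l.drop (x + 1))) j else 0) else 0 := by
    rw [replaceAll, Finset.sum_mul]
    refine Finset.sum_congr rfl fun x _ => ?_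
    by_cases ha : l[x]? = some a
    · rw [if_pos ha, if_pos ha, pathOrZero_mul_of hq (isPath_replace hp hγ ha)]
    · rw [if_neg ha, if_neg ha, zero_mul]
  have e2 : PathAlg.of k ⟨i, j, l, hp⟩ * Q.replaceAll k ⟨i', j', l', hq⟩ a γ =
      ∑ x ∈ Finset.range l'.length, if l'[x]? = some a then
        (if j' = i then PathAlg.pathOrZero k Q.toFinQuiver i'
          ((l'.take x ++ γ.arrows ++ l'.drop (x + 1)) ++ l) j else 0) else 0 := by
    rw [replaceAll, Finset.mul_sum]
    refine Finset.sum_congr rfl fun x _ => ?_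
    by_cases ha : l'[x]? = some a
    · rw [if_pos ha, if_pos ha, of_mul_pathOrZero (isPath_replace hq hγ ha) hp]
    · rw [if_neg ha, if_neg ha, mul_zero]
  rw [e1, e2]
  by_cases hm : j' = i
  · subst hm
    rw [PathAlg.of_mul_of_comp, subst_single_of, replaceAll]
    simp only [if_true, List.length_append]
    rw [Finset.sum_range_add, add_comm]
    refine congrArg₂ (· + ·) (Finset.sum_congr rfl fun x _ => ?_)
      (Finset.sum_congr rfl fun x hx => ?_)
    · rw [List.getElem?_append_right (by omega), Nat.add_sub_cancel_left]
      congr 2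
      rw [List.take_append, List.drop_append, List.take_of_length_le (by omega),
        List.drop_eq_nil_of_le (by omega)]
      simp [Nat.add_assoc]
    · have hx' : x < l'.length := Finset.mem_range.1 hx
      rw [List.getElem?_append_left hx']
      congr 2
      rw [List.take_append_of_le_length hx'.le, List.drop_append_of_le_length hx']
      simp
  · rw [PathAlg.of_mul_of_ne hm]
    simp [hm]

theorem subst_mul {x : Q.Arr × Q.Path →₀ k} (hx : x ∈ Q.C1 k)
    (f g : PathAlg k Q.toFinQuiver) :
    Q.subst k x (f * g) = Q.subst k x f * g + f * Q.subst k x g := by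
  refine C1_induction (P := fun x => Q.subst k x (f * g) = Q.subst k x f * g + f * Q.subst k x g)
    (by simp) (fun x y hx hy => ?_) (fun c x hx => ?_) (fun a γ _ h1 h2 => ?_) hx
  · simp only [map_add, LinearMap.add_apply, hx, hy, add_mul, mul_add]; abel
  · simp only [map_smul, LinearMap.smul_apply, hx, smul_add, smul_mul_assoc, mul_smul_comm]
  refine PathAlg.induction_paths (P := fun f => Q.subst k (Finsupp.single (a, γ) 1) (f * g) =
      Q.subst k (Finsupp.single (a, γ) 1) f * g + f * Q.subst k (Finsupp.single (a, γ) 1) g)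
    (by simp) (fun x y hx hy => ?_) (fun c x hx => ?_) (fun p => ?_) f
  · simp only [map_add, hx, hy, add_mul]; abel
  · simp only [map_smul, hx, smul_add, smul_mul_assoc]
  refine PathAlg.induction_paths (P := fun g => Q.subst k (Finsupp.single (a, γ) 1)
      (PathAlg.of k p * g) = Q.subst k (Finsupp.single (a, γ) 1) (PathAlg.of k p) * g +
        PathAlg.of k p * Q.subst k (Finsupp.single (a, γ) 1) g)
    (by simp) (fun x y hx hy => ?_) (fun c x hx => ?_) (fun q => ?_) g
  · simp only [map_add, hx, hy, mul_add]; abel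
  · simp only [map_smul, hx, smul_add, mul_smul_comm]
  rw [subst_single_of, subst_single_of, replaceAll_mul _ _ _ _ h1 h2]

theorem subst_vertex (x : Q.Arr × Q.Path →₀ k) (p : Q.Path) (hp : p.arrows = []) :
    Q.subst k x (PathAlg.of k p) = 0 := by
  refine pairs_induction (P := fun x => Q.subst k x (PathAlg.of k p) = 0)
    (by simp) (fun x y hx hy => ?_) (fun c x hx => ?_) (fun a γ => ?_) x
  · rw [map_add, LinearMap.add_apply, hx, hy, add_zero]
  · rw [map_smul, LinearMap.smul_apply, hx, smul_zero]
  · rw [subst_single_of, replaceAll, hp]; rfl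

theorem subst_arrow {x : Q.Arr × Q.Path →₀ k} (hx : x ∈ Q.C1 k) (a : Q.Arr) :
    Q.subst k x (PathAlg.of k (FinQuiver.Path.arrow Q.toFinQuiver a)) = Q.val k a x := by
  refine C1_induction (P := fun x => Q.subst k x
      (PathAlg.of k (FinQuiver.Path.arrow Q.toFinQuiver a)) = Q.val k a x)
    (by simp) (fun x y hx hy => ?_) (fun c x hx => ?_) (fun b γ _ h1 h2 => ?_) hx
  · rw [map_add, LinearMap.add_apply, hx, hy, map_add]
  · rw [map_smul, LinearMap.smul_apply, hx, map_smul]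
  · rw [subst_single_of, replaceAll, val_single]
    simp only [FinQuiver.Path.arrow, List.length_singleton, Finset.range_one,
      Finset.sum_singleton, List.getElem?_cons_zero, Option.some.injEq, List.take_zero,
      List.nil_append, zero_add, List.drop_one, List.tail_cons, List.append_nil]
    by_cases hb : a = b
    · subst hb
      obtain ⟨i, j, l, hγ⟩ := γ
      subst h1 h2
      rw [if_pos rfl, if_pos rfl, PathAlg.pathOrZero_of_isPath hγ]
    · rw [if_neg hb, if_neg (Ne.symm hb)]

theorem trunc_subst_rel {x : Q.Arr × Q.Path →₀ k} (hx : x ∈ Q.kerDelta1 k) {r : Q.Path}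
    (hr : r ∈ Q.rel) : Q.trunc k (Q.subst k x (PathAlg.of k r)) = 0 := by
  rw [← val_delta1 hr, LinearMap.mem_ker.1 hx.2, map_zero]

theorem trunc_subst_trunc {x : Q.Arr × Q.Path →₀ k} (hx : x ∈ Q.kerDelta1 k)
    (f : PathAlg k Q.toFinQuiver) :
    Q.trunc k (Q.subst k x (Q.trunc k f)) = Q.trunc k (Q.subst k x f) := by
  refine PathAlg.induction_paths (P := fun f =>
      Q.trunc k (Q.subst k x (Q.trunc k f)) = Q.trunc k (Q.subst k x f))
    (by simp) (fun x y hx hy => by simp only [map_add, hx, hy])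
    (fun c x hx => by simp only [map_smul, hx]) (fun p => ?_) f
  rw [trunc_of]
  split_ifs with hp
  · rfl
  rw [map_zero, map_zero]
  simp only [IsBasic, not_forall, not_not] at hp
  obtain ⟨r, hr, u, v, huv⟩ := hp
  obtain ⟨i, j, l, hl⟩ := p
  obtain ⟨i', j', l', hl'⟩ := r
  simp only at huv
  subst huv
  obtain ⟨m', h12, h3⟩ := Q.isPath_append.1 hl
  obtain ⟨m, h1, h2⟩ := Q.isPath_append.1 h12
  have hne : l' ≠ [] := by
    have := Q.two_le_length _ hr
    rintro rfl
    simp at this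
  obtain ⟨a, l'', rfl⟩ := List.exists_cons_of_ne_nil hne
  obtain rfl : i' = m := hl'.1.symm.trans h2.1
  obtain rfl : j' = m' := hl'.target_unique h2
  have e : (PathAlg.of k ⟨i, j, u ++ (a :: l'') ++ v, hl⟩ : PathAlg k Q.toFinQuiver) =
      PathAlg.of k ⟨j', j, v, h3⟩ * (PathAlg.of k ⟨i', j', a :: l'', hl'⟩ *
        PathAlg.of k ⟨i, i', u, h1⟩) := by
    rw [PathAlg.of_mul_of_comp, PathAlg.of_mul_of_comp]
  have t0 : Q.trunc k (PathAlg.of k ⟨i', j', a :: l'', hl'⟩) = 0 := by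
    rw [trunc_of, if_neg]
    exact fun hb => hb _ hr List.infix_rfl
  have t1 := trunc_subst_rel hx hr
  rw [e, subst_mul hx.1, subst_mul hx.1, mul_add, map_add, map_add]
  have z1 : ∀ f g : PathAlg k Q.toFinQuiver,
      Q.trunc k (f * (PathAlg.of k ⟨i', j', a :: l'', hl'⟩ * g)) = 0 := by
    intro f g
    rw [← trunc_mul_right, ← trunc_mul_left (PathAlg.of k _), t0, zero_mul, map_zero, mul_zero,
      map_zero]
  have z2 : ∀ f g : PathAlg k Q.toFinQuiver,
      Q.trunc k (f * (Q.subst k x (PathAlg.of k ⟨i', j', a :: l'', hl'⟩) * g)) = 0 := by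
    intro f g
    rw [← trunc_mul_right, ← trunc_mul_left (Q.subst k x _), t1, zero_mul, map_zero, mul_zero,
      map_zero]
  rw [z1, z1, z2, add_zero, add_zero]

theorem pair_replace_mem (a : Q.Arr) (γ : Q.Path) {b : Q.Arr} {ε : Q.Path}
    (h1 : ε.source = Q.src b) (h2 : ε.target = Q.tgt b) :
    Q.pair k b (Q.replace k ε a γ) ∈ Q.C1 k := by
  rw [replace, replaceAll, map_sum, map_sum]
  refine Submodule.sum_mem _ fun i _ => ?_
  split_ifs
  · rw [PathAlg.pathOrZero]
    split_ifs
    · rw [trunc_of]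
      split_ifs with hb
      · rw [pair_of]
        exact Finsupp.single_mem_supported k 1 ⟨hb, h1, h2⟩
      · simp
    · simp
  · simp

theorem br_mem_C1 {x y : Q.Arr × Q.Path →₀ k} (hx : x ∈ Q.C1 k) (hy : y ∈ Q.C1 k) :
    Q.br k x y ∈ Q.C1 k := by
  refine C1_induction (P := fun x => Q.br k x y ∈ Q.C1 k)
    (by simp) (fun x y hx hy => ?_) (fun c x hx => ?_) (fun a γ _ h1 h2 => ?_) hx
  · rw [map_add]; exact Submodule.add_mem _ hx hy
  · rw [map_smul]; exact Submodule.smul_mem _ _ hx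
  refine C1_induction (P := fun y => Q.br k (Finsupp.single (a, γ) 1) y ∈ Q.C1 k)
    (by simp) (fun x y hx hy => ?_) (fun c x hx => ?_) (fun b ε _ h3 h4 => ?_) hy
  · rw [map_add]; exact Submodule.add_mem _ hx hy
  · rw [map_smul]; exact Submodule.smul_mem _ _ hx
  rw [br_single]
  exact Submodule.sub_mem _ (pair_replace_mem _ _ h3 h4) (pair_replace_mem _ _ h1 h2)

theorem trunc_subst_br {x y : Q.Arr × Q.Path →₀ k} (hx : x ∈ Q.kerDelta1 k)
    (hy : y ∈ Q.kerDelta1 k) (f : PathAlg k Q.toFinQuiver) :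
    Q.trunc k (Q.subst k (Q.br k x y) f) =
      Q.trunc k (Q.subst k x (Q.subst k y f)) - Q.trunc k (Q.subst k y (Q.subst k x f)) := by
  refine PathAlg.induction_paths (P := fun f => Q.trunc k (Q.subst k (Q.br k x y) f) =
      Q.trunc k (Q.subst k x (Q.subst k y f)) - Q.trunc k (Q.subst k y (Q.subst k x f)))
    (by simp) (fun x y hx hy => ?_) (fun c x hx => ?_) (fun p => ?_) f
  · simp only [map_add, hx, hy]; abel
  · simp only [map_smul, hx, smul_sub]
  have key : ∀ (l : List Q.Arr) (i j : Fin n) (h : Q.IsPath i l j),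
      Q.trunc k (Q.subst k (Q.br k x y) (PathAlg.of k ⟨i, j, l, h⟩)) =
      Q.trunc k (Q.subst k x (Q.subst k y (PathAlg.of k ⟨i, j, l, h⟩))) -
        Q.trunc k (Q.subst k y (Q.subst k x (PathAlg.of k ⟨i, j, l, h⟩))) := by
    intro l
    induction l with
    | nil =>
      intro i j h
      have hz : ∀ z : Q.Arr × Q.Path →₀ k, Q.subst k z (PathAlg.of k ⟨i, j, [], h⟩) = 0 :=
        fun z => subst_vertex z _ rfl
      simp only [hz, map_zero, sub_zero]
    | cons a l ih =>
      intro i j hal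
      obtain ⟨rfl, h⟩ := id hal
      have e : (PathAlg.of k ⟨Q.src a, j, a :: l, hal⟩ : PathAlg k Q.toFinQuiver) =
          PathAlg.of k ⟨Q.tgt a, j, l, h⟩ *
            PathAlg.of k (FinQuiver.Path.arrow Q.toFinQuiver a) := by
        exact (PathAlg.of_mul_of_comp (k := k) (Q := Q.toFinQuiver) (i := Q.src a) (l := [a])
          (FinQuiver.Path.arrow Q.toFinQuiver a).isPath h).symm
      have ha : Q.trunc k (Q.subst k (Q.br k x y)
          (PathAlg.of k (FinQuiver.Path.arrow Q.toFinQuiver a))) =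
          Q.trunc k (Q.subst k x (Q.subst k y
            (PathAlg.of k (FinQuiver.Path.arrow Q.toFinQuiver a)))) -
          Q.trunc k (Q.subst k y (Q.subst k x
            (PathAlg.of k (FinQuiver.Path.arrow Q.toFinQuiver a)))) := by
        rw [subst_arrow (br_mem_C1 hx.1 hy.1), subst_arrow hx.1, subst_arrow hy.1, val_br,
          map_sub, trunc_trunc, trunc_trunc]
      have hl := ih (Q.tgt a) j h
      rw [e]
      generalize PathAlg.of k ⟨Q.tgt a, j, l, h⟩ = f at hl
      generalize PathAlg.of k (FinQuiver.Path.arrow Q.toFinQuiver a) = g at ha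
      simp only [subst_mul (br_mem_C1 hx.1 hy.1), subst_mul hx.1, subst_mul hy.1, map_add]
      rw [← trunc_mul_left (Q.subst k (Q.br k x y) f), hl,
        ← trunc_mul_right _ (Q.subst k (Q.br k x y) g), ha]
      rw [sub_mul, mul_sub, map_sub, map_sub]
      simp only [trunc_mul_left, trunc_mul_right]
      abel
  exact key p.arrows p.source p.target p.isPath

theorem br_mem {x y : Q.Arr × Q.Path →₀ k} (hx : x ∈ Q.kerDelta1 k) (hy : y ∈ Q.kerDelta1 k) :
    Q.br k x y ∈ Q.kerDelta1 k := by
  refine ⟨br_mem_C1 hx.1 hy.1, ?_⟩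
  have h : ∀ z : Q.Arr × Q.Path →₀ k, Q.delta1 k z =
      ∑ r ∈ Q.rel_finite.toFinset, Q.pair k r (Q.trunc k (Q.subst k z (PathAlg.of k r))) := by
    intro z
    refine pairs_induction (P := fun z => Q.delta1 k z =
        ∑ r ∈ Q.rel_finite.toFinset, Q.pair k r (Q.trunc k (Q.subst k z (PathAlg.of k r))))
      (by simp) (fun x x' hx hx' => ?_) (fun r x hx => ?_) (fun a γ => ?_) z
    · simp only [map_add, LinearMap.add_apply, hx, hx', Finset.sum_add_distrib]
    · simp only [map_smul, LinearMap.smul_apply, hx, Finset.smul_sum]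
    · rw [delta1, Finsupp.linearCombination_single, one_smul]
      simp only [subst_single_of, replace]
  refine LinearMap.mem_ker.2 ?_
  rw [h]
  refine Finset.sum_eq_zero fun r hr => ?_
  have hr' : r ∈ Q.rel := by simpa using hr
  rw [trunc_subst_br hx hy, ← trunc_subst_trunc hx, ← trunc_subst_trunc hy (Q.subst k x _),
    trunc_subst_rel hx hr', trunc_subst_rel hy hr']
  simp

/-- The bracket on `Ker δ¹`. -/
instance : Bracket (Q.kerDelta1 k) (Q.kerDelta1 k) :=
  ⟨fun x y => ⟨Q.br k x.1 y.1, br_mem x.2 y.2⟩⟩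

theorem coe_lie (x y : Q.kerDelta1 k) : (⁅x, y⁆ : Q.kerDelta1 k).1 = Q.br k x.1 y.1 := rfl

instance : LieRing (Q.kerDelta1 k) where
  add_lie x y z := Subtype.ext <| by
    simp only [coe_lie, Submodule.coe_add, map_add, LinearMap.add_apply]
  lie_add x y z := Subtype.ext <| by
    simp only [coe_lie, Submodule.coe_add, map_add]
  lie_self x := Subtype.ext <| val_ext fun a => by
    rw [coe_lie, val_br, sub_self]; exact (map_zero _).symm
  leibniz_lie x y z := Subtype.ext <| val_ext fun a => by
    simp only [coe_lie, Submodule.coe_add, map_add, val_br, map_sub, trunc_subst_trunc x.2,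
      trunc_subst_trunc y.2, trunc_subst_trunc z.2, trunc_subst_br x.2 y.2,
      trunc_subst_br x.2 z.2, trunc_subst_br y.2 z.2]
    abel

instance : LieAlgebra k (Q.kerDelta1 k) where
  lie_smul c x y := Subtype.ext <| by
    simp only [coe_lie, Submodule.coe_smul, map_smul]

variable (k)

/-- The derivation `D` of the monomial algebra corresponds to `x = ∑ λ_{a//p} a//p`: it vanishes
on the vertices, and `D(a) = ∑_p λ_{a//p} p` for every arrow `a`. -/
def Represents (x : Q.Arr × Q.Path →₀ k) (D : algDer k (Q.Alg k)) : Prop :=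
  (∀ i, D.1 (Q.cls k (FinQuiver.Path.vertex Q.toFinQuiver i)) = 0) ∧
    ∀ a, D.1 (Q.cls k (FinQuiver.Path.arrow Q.toFinQuiver a)) =
      Ideal.Quotient.mk _ (Q.val k a x)

/-! ### Dual extensions -/

/-- The presentation of the opposite of a monomial algebra. -/
def op (A : MonomialQuiver.{u} n) : MonomialQuiver.{u} n where
  toFinQuiver := A.toFinQuiver.op
  rel := FinQuiver.Path.op '' A.rel
  rel_finite := A.rel_finite.image _
  two_le_length := by
    rintro _ ⟨r, hr, rfl⟩
    simpa [FinQuiver.Path.op] using A.two_le_length r hr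
  rel_minimal := by
    rintro _ ⟨r, hr, rfl⟩ _ ⟨s, hs, rfl⟩ h
    rw [A.rel_minimal r hr s hs (List.reverse_infix.1 h)]

/-- The path `αβ` (first `β`, then `α`), for an arrow `α` of `Q` and an arrow `β` of `R`. -/
def mixedRel (Q R : FinQuiver.{u} n) (α : Q.Arr) (β : R.Arr) (h : R.tgt β = Q.src α) :
    (Q.union R).Path :=
  ⟨R.src β, Q.tgt α, [Sum.inr β, Sum.inl α], rfl, h.symm, rfl⟩

theorem mixedRel_finite (Q R : FinQuiver.{u} n) :
    {p | ∃ α β h, p = mixedRel Q R α β h}.Finite := by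
  refine (Set.finite_range (fun x : {x : Q.Arr × R.Arr // R.tgt x.2 = Q.src x.1} =>
    mixedRel Q R x.1.1 x.1.2 x.2)).subset ?_
  rintro _ ⟨α, β, h, rfl⟩
  exact ⟨⟨(α, β), h⟩, rfl⟩

theorem inl_injective (Q R : FinQuiver.{u} n) :
    Function.Injective (FinQuiver.Path.inl R : Q.Path → (Q.union R).Path) := by
  intro p q h
  have h1 := congrArg FinQuiver.Path.source h
  have h2 := congrArg FinQuiver.Path.target h
  have h3 := congrArg FinQuiver.Path.arrows h
  exact FinQuiver.Path.ext h1 h2 (List.map_injective_iff.2 Sum.inl_injective h3)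

theorem map_infix_map {α β : Type*} {f : α → β} (hf : Function.Injective f) {l l' : List α}
    (h : l.map f <:+: l'.map f) : l <:+: l' := by
  obtain ⟨s, t, hst⟩ := h
  obtain ⟨u, v, rfl, hu, rfl⟩ := List.map_eq_append_iff.1 hst.symm
  obtain ⟨u, w, rfl, rfl, hw⟩ := List.map_eq_append_iff.1 hu
  rw [List.map_injective_iff.2 hf hw]
  exact ⟨u, v, rfl⟩

/-- The dual extension `Λ(B, Aᵒᵖ)`: its arrows are those of `B` and of `Aᵒᵖ`, and its relations are
those of `B`, those of `Aᵒᵖ`, and all paths `αβ` (first `β`, then `α`) with `α` an arrow of `B` and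
`β` an arrow of `Aᵒᵖ`. -/
def dualExt (B A : MonomialQuiver.{u} n) : MonomialQuiver.{u} n where
  toFinQuiver := B.toFinQuiver.union A.op.toFinQuiver
  rel := FinQuiver.Path.inl A.op.toFinQuiver '' B.rel ∪
    FinQuiver.Path.inr B.toFinQuiver '' A.op.rel ∪
    {p | ∃ α β h, p = mixedRel B.toFinQuiver A.op.toFinQuiver α β h}
  rel_finite := ((B.rel_finite.image _).union (A.op.rel_finite.image _)).union
    (mixedRel_finite _ _)
  two_le_length := by
    rintro _ ((⟨r, hr, rfl⟩ | ⟨r, hr, rfl⟩) | ⟨α, β, h, rfl⟩)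
    · simpa [FinQuiver.Path.inl] using B.two_le_length r hr
    · simpa [FinQuiver.Path.inr] using A.op.two_le_length r hr
    · exact le_rfl
  rel_minimal := by
    rintro _ ((⟨r, hr, rfl⟩ | ⟨r, hr, rfl⟩) | ⟨α, β, h, rfl⟩) _
      ((⟨s, hs, rfl⟩ | ⟨s, hs, rfl⟩) | ⟨α', β', h', rfl⟩) hrs
    · rw [B.rel_minimal r hr s hs (map_infix_map Sum.inl_injective hrs)]
    · exfalso
      have h2 := B.two_le_length r hr
      obtain ⟨a, l, hl⟩ := List.exists_cons_of_length_pos (by omega : 0 < r.arrows.length)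
      have := hrs.subset (show Sum.inl a ∈ (FinQuiver.Path.inl _ r).arrows by
        simp [FinQuiver.Path.inl, hl])
      simp [FinQuiver.Path.inr] at this
    · exfalso
      have h2 := B.two_le_length r hr
      have e := hrs.eq_of_length_le (by simpa [FinQuiver.Path.inl, mixedRel] using h2)
      have : Sum.inr β' ∈ (FinQuiver.Path.inl A.op.toFinQuiver r).arrows := by
        rw [e]; simp [mixedRel]
      simp [FinQuiver.Path.inl] at this
    · exfalso
      have h2 := A.op.two_le_length r hr
      obtain ⟨a, l, hl⟩ := List.exists_cons_of_length_pos (by omega : 0 < r.arrows.length)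
      have := hrs.subset (show Sum.inr a ∈ (FinQuiver.Path.inr _ r).arrows by
        simp [FinQuiver.Path.inr, hl])
      simp [FinQuiver.Path.inl] at this
    · rw [A.op.rel_minimal r hr s hs (map_infix_map Sum.inr_injective hrs)]
    · exfalso
      have h2 := A.op.two_le_length r hr
      have e := hrs.eq_of_length_le (by simpa [FinQuiver.Path.inr, mixedRel] using h2)
      have : Sum.inl α' ∈ (FinQuiver.Path.inr B.toFinQuiver r).arrows := by
        rw [e]; simp [mixedRel]
      simp [FinQuiver.Path.inr] at this
    · exfalso
      have := hrs.subset (show Sum.inr β ∈ (mixedRel _ _ α β h).arrows by simp [mixedRel])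
      simp [FinQuiver.Path.inl] at this
    · exfalso
      have := hrs.subset (show Sum.inl α ∈ (mixedRel _ _ α β h).arrows by simp [mixedRel])
      simp [FinQuiver.Path.inr] at this
    · have e := hrs.eq_of_length rfl
      simp only [mixedRel, List.cons.injEq, Sum.inr.injEq, Sum.inl.injEq, and_true] at e
      obtain ⟨rfl, rfl⟩ := e
      rfl

section DualExtension

variable (B A : MonomialQuiver.{u} n)

/-- An arrow of `B`, as an arrow of the dual extension. -/
def arrB (b : B.Arr) : (dualExt B A).Arr := Sum.inl b

/-- An arrow of `Aᵒᵖ`, as an arrow of the dual extension. -/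
def arrA (a : A.op.Arr) : (dualExt B A).Arr := Sum.inr a

/-- A path of `B`, as a path of the dual extension. -/
def pathB (p : B.Path) : (dualExt B A).Path := FinQuiver.Path.inl A.op.toFinQuiver p

variable {B A} in
/-- The path is of the form `q_m ⋯ q_1 p_l ⋯ p_1` with `l, m ≥ 1`, arrows `p_i` of `B` and arrows
`q_j` of `Aᵒᵖ`. -/
def IsMixed (p : (dualExt B A).Path) : Prop :=
  ∃ (l : List B.Arr) (m : List A.op.Arr), l ≠ [] ∧ m ≠ [] ∧
    p.arrows = l.map (arrB B A) ++ m.map (arrA B A)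

/-- `𝒥'`: the part of `Ker δ¹_Λ` in the span of the `b//p` with `b` an arrow of `B` and `p` a mixed
path in `ℬ_Λ`. -/
def idealJ' : Submodule k ((dualExt B A).Arr × (dualExt B A).Path →₀ k) :=
  (dualExt B A).kerDelta1 k ⊓
    Finsupp.supported k k {ap | (∃ b, ap.1 = arrB B A b) ∧ IsBasic ap.2 ∧ IsMixed ap.2}

/-- `Ker δ¹_{Λ|B}`: the elements of `Ker δ¹_Λ` that vanish on the arrows of `B`. -/
def kerRel : Submodule k ((dualExt B A).Arr × (dualExt B A).Path →₀ k) :=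
  (dualExt B A).kerDelta1 k ⊓ ⨅ b, LinearMap.ker ((dualExt B A).val k (arrB B A b))

/-- `𝒥 = 𝒥' + Ker δ¹_{Λ|B}`. -/
def idealJ : Submodule k ((dualExt B A).Arr × (dualExt B A).Path →₀ k) :=
  idealJ' k B A ⊔ kerRel k B A

/-- `ℐ`: the part of `Im δ⁰_Λ` of degree at least two, where `a//p` has degree the length of
`p`. -/
def idealI : Submodule k ((dualExt B A).Arr × (dualExt B A).Path →₀ k) :=
  (dualExt B A).imDelta0 k ⊓ Finsupp.supported k k {ap | 2 ≤ ap.2.arrows.length}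

/-- The linear projection of `k((Q_Λ)₁//ℬ_Λ)` that keeps the pairs `b//p` with `b` an arrow and `p`
a path of `B`, and kills all others. -/
def projB : ((dualExt B A).Arr × (dualExt B A).Path →₀ k) →ₗ[k] (B.Arr × B.Path →₀ k) :=
  Finsupp.lcomapDomain (Prod.map (arrB B A) (pathB B A))
    (Function.Injective.prodMap Sum.inl_injective (inl_injective _ _))

end DualExtension

end MonomialQuiver

end

/-!
Modulo inner derivations a derivation of a monomial algebra kills the vertices, as these are
complete orthogonal idempotents. So `HH¹` is the quotient of `Ker δ¹` by `Im δ⁰`, and `Im δ⁰`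
consists of the elements `∑_a a//(a f - f a)` with `f` a combination of oriented cycles in `ℬ`.

In the dual extension `Λ` an arrow of `B` never follows an arrow of `Aᵒᵖ`, so a basic path runs
first along `B` and then along `Aᵒᵖ`. By directedness, a basic path parallel to an arrow of `B` must
start with an arrow of `B`, and one parallel to an arrow of `Aᵒᵖ` is not a path of `B`. Hence
keeping the terms `b//p` of `B` is a surjective morphism `Ker δ¹_Λ → Ker δ¹_B` of Lie algebras; its
kernel is `𝒥`, and it maps `Im δ⁰_Λ` onto `Im δ⁰_B`. The exact sequence is then a diagram chase over
`HH¹(Λ) → HH¹(B)`, with `𝒥 ∩ Im δ⁰_Λ` in the place of `ℐ`.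

These two agree: the element of `Im δ⁰_Λ` given by `f` projects to zero exactly when the vertex
coefficients of `f` are constant along the arrows of `B`. As the endpoints of each arrow of `A` are
linked in `B`, they are then constant along the arrows of `Aᵒᵖ` as well, which leaves only terms of
degree at least `2`.
-/

noncomputable section

open scoped Classical

universe u

/-! ### A three by three lemma for Lie algebras -/

section LieAlgebra

variable {R K L H H' : Type*} [CommRing R] [LieRing K] [LieAlgebra R K] [LieRing L]
  [LieAlgebra R L] [LieRing H] [LieAlgebra R H] [LieRing H'] [LieAlgebra R H']

theorem exists_lieHom_comp_eq {p : K →ₗ⁅R⁆ L} (hp : Function.Surjective p) (q : K →ₗ⁅R⁆ H)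
    (h : ∀ x, p x = 0 → q x = 0) : ∃ g : L →ₗ⁅R⁆ H, ∀ x, g (p x) = q x := by
  have hq : ∀ x y, p x = p y → q x = q y := fun x y hxy => by
    rw [← sub_eq_zero, ← map_sub]
    exact h _ (by rw [map_sub, hxy, sub_self])
  let s := Function.surjInv hp
  have hs : ∀ y, p (s y) = y := Function.surjInv_eq hp
  let g : L →ₗ⁅R⁆ H :=
    { toFun := fun y => q (s y)
      map_add' := fun y z => by
        rw [← map_add]
        exact hq _ _ (by rw [map_add, hs, hs, hs])
      map_smul' := fun c y => by
        rw [RingHom.id_apply, ← map_smul]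
        exact hq _ _ (by rw [map_smul, hs, hs])
      map_lie' := fun {y z} => by
        rw [← LieHom.map_lie]
        exact hq _ _ (by rw [LieHom.map_lie, hs, hs, hs]) }
  exact ⟨g, fun x => hq _ _ (hs _)⟩

theorem exists_quotient_lieHom (I : LieIdeal R K) (q : K →ₗ⁅R⁆ H) (h : ∀ x ∈ I, q x = 0) :
    ∃ f : (K ⧸ I) →ₗ⁅R⁆ H, ∀ x, f (LieSubmodule.Quotient.mk x) = q x :=
  exists_lieHom_comp_eq
    (p := { (LieSubmodule.Quotient.mk' I : K →ₗ[R] K ⧸ I) with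
      map_lie' := fun {x y} => LieSubmodule.Quotient.mk_bracket I x y })
    (LieSubmodule.Quotient.surjective_mk' I) q
    fun x hx => h x ((LieSubmodule.Quotient.mk_eq_zero I).1 hx)

theorem exists_exact_quotient_ker {π : K →ₗ⁅R⁆ L} {p : K →ₗ⁅R⁆ H} {q : L →ₗ⁅R⁆ H'}
    (hπ : Function.Surjective π) (hp : Function.Surjective p) (hq : Function.Surjective q)
    (h : ∀ y, q y = 0 ↔ ∃ x, p x = 0 ∧ π x = y) :
    ∃ (f : (π.ker ⧸ (p.comp π.ker.incl).ker) →ₗ⁅R⁆ H) (g : H →ₗ⁅R⁆ H'),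
      Function.Injective f ∧ Function.Exact f g ∧ Function.Surjective g ∧
      (∀ x, f (LieSubmodule.Quotient.mk x) = p x.1) ∧ ∀ x, g (p x) = q (π x) := by
  obtain ⟨f, hf⟩ := exists_quotient_lieHom _ (p.comp π.ker.incl) fun x => LieHom.mem_ker.1
  obtain ⟨g, hg⟩ := exists_lieHom_comp_eq hp (q.comp π) fun x hx => (h _).2 ⟨x, hx, rfl⟩
  refine ⟨f, g, ?_, fun u => ⟨fun hu => ?_, ?_⟩, fun w => ?_, hf, hg⟩
  · refine (injective_iff_map_eq_zero f).2 fun u hu => ?_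
    obtain ⟨x, rfl⟩ := LieSubmodule.Quotient.surjective_mk' _ u
    exact (LieSubmodule.Quotient.mk_eq_zero _).2 (LieHom.mem_ker.2 ((hf x).symm.trans hu))
  · obtain ⟨x, rfl⟩ := hp u
    obtain ⟨z, hz, hzx⟩ := (h (π x)).1 ((hg x).symm.trans hu)
    have hxz : x - z ∈ π.ker := LieHom.mem_ker.2 (by rw [map_sub, hzx, sub_self])
    refine ⟨LieSubmodule.Quotient.mk ⟨x - z, hxz⟩, ?_⟩
    rw [hf]
    change p (x - z) = p x
    rw [map_sub, hz, sub_zero]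
  · rintro ⟨v, rfl⟩
    obtain ⟨x, rfl⟩ := LieSubmodule.Quotient.surjective_mk' _ v
    change g (f (LieSubmodule.Quotient.mk x)) = 0
    rw [hf]
    change g (p x.1) = 0
    rw [hg, LieHom.comp_apply, LieHom.mem_ker.1 x.2, map_zero]
  · obtain ⟨x, hx⟩ := (hq.comp hπ) w
    exact ⟨p x, (hg x).trans hx⟩

end LieAlgebra

/-! ### Quivers -/

namespace FinQuiver

variable {n : ℕ} {Q : FinQuiver.{u} n}

theorem eq_of_linked {β : Type*} {f : Fin n → β} (hf : ∀ a, f (Q.src a) = f (Q.tgt a))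
    {i j : Fin n} (h : Q.Linked i j) : f i = f j := by
  induction h with
  | rel i j h => obtain ⟨a, rfl, rfl⟩ := h; exact hf a
  | refl i => rfl
  | symm i j _ ih => exact ih.symm
  | trans i j l _ _ ih ih' => exact ih.trans ih'

theorem IsDirected.le_of_isPath (hQ : Q.IsDirected) {l : List Q.Arr} {i j : Fin n}
    (h : Q.IsPath i l j) : i ≤ j := by
  induction l generalizing i with
  | nil => exact le_of_eq h
  | cons a l ih =>
    obtain ⟨rfl, h⟩ := h
    exact (hQ a).le.trans (ih h)

theorem IsDirected.eq_nil_of_isPath (hQ : Q.IsDirected) {l : List Q.Arr} {i : Fin n}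
    (h : Q.IsPath i l i) : l = [] := by
  cases l with
  | nil => rfl
  | cons a l =>
    obtain ⟨rfl, h⟩ := h
    exact absurd (hQ.le_of_isPath h) (hQ a).not_ge

theorem Path.vertex_inj {i j : Fin n} : Path.vertex Q i = Path.vertex Q j ↔ i = j :=
  ⟨fun h => congrArg Path.source h, fun h => h ▸ rfl⟩

theorem Path.eq_vertex {p : Q.Path} (h : p.arrows = []) : p = Path.vertex Q p.source := by
  obtain ⟨i, j, l, hp⟩ := p
  obtain rfl : l = [] := h
  obtain rfl : i = j := hp
  rfl

end FinQuiver

/-! ### The path algebra in coordinates -/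

namespace PathAlg

open FinQuiver

variable {n : ℕ} {k : Type*} [Field k] {Q : FinQuiver.{u} n}

/-- The coefficient of a path in an element of the path algebra. -/
def coef (p : Q.Path) : PathAlg k Q →ₗ[k] k := Finsupp.lapply p

theorem coef_of (p q : Q.Path) : coef p (of k q) = if q = p then 1 else 0 :=
  Finsupp.single_apply

theorem ext_coef {f g : PathAlg k Q} (h : ∀ p, coef p f = coef p g) : f = g :=
  Finsupp.ext h

theorem hom_ext {M : Type*} [AddCommGroup M] [Module k M] {φ ψ : PathAlg k Q →ₗ[k] M}
    (h : ∀ p, φ (of k p) = ψ (of k p)) : φ = ψ :=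
  Finsupp.lhom_ext' fun p => LinearMap.ext_ring (h p)

variable (k) in
/-- The span of a set of paths. -/
def spanOf (S : Set Q.Path) : Submodule k (PathAlg k Q) := Submodule.span k (of k '' S)

theorem of_mem_spanOf {S : Set Q.Path} {p : Q.Path} (hp : p ∈ S) : of k p ∈ spanOf k S :=
  Submodule.subset_span ⟨p, hp, rfl⟩

theorem mem_spanOf_iff {S : Set Q.Path} {f : PathAlg k Q} :
    f ∈ spanOf k S ↔ ∀ p ∉ S, coef p f = 0 := by
  have h : spanOf k S = Finsupp.supported k k S := (Finsupp.supported_eq_span_single k S).symm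
  rw [h]
  exact Finsupp.mem_supported' k f

theorem map_spanOf_le {S : Set Q.Path} {M : Type*} [AddCommGroup M] [Module k M]
    {φ : PathAlg k Q →ₗ[k] M} {N : Submodule k M} (h : ∀ p ∈ S, φ (of k p) ∈ N) :
    (spanOf k S).map φ ≤ N := by
  rw [spanOf, Submodule.map_span, Submodule.span_le]
  rintro _ ⟨_, ⟨p, hp, rfl⟩, rfl⟩
  exact h p hp

theorem of_cons {a : Q.Arr} {l : List Q.Arr} {i j : Fin n} (h : Q.IsPath i (a :: l) j) :
    of k (⟨i, j, a :: l, h⟩ : Q.Path) =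
      of k (⟨Q.tgt a, j, l, h.2⟩ : Q.Path) * of k (Path.arrow Q a) := by
  obtain ⟨rfl, h'⟩ := id h
  exact (of_mul_of_comp (l := [a]) (Path.arrow Q a).isPath h').symm

theorem vertex_mul_of (i : Fin n) (p : Q.Path) :
    of k (Path.vertex Q i) * of k p = if p.target = i then of k p else 0 := by
  obtain ⟨s, t, l, h⟩ := p
  split_ifs with hi
  · obtain rfl : t = i := hi
    have := of_mul_of_comp (k := k) h (show Q.IsPath t [] t from rfl)
    simp only [List.append_nil] at this
    exact this
  · exact of_mul_of_ne hi

theorem of_mul_vertex (i : Fin n) (p : Q.Path) :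
    of k p * of k (Path.vertex Q i) = if p.source = i then of k p else 0 := by
  obtain ⟨s, t, l, h⟩ := p
  split_ifs with hi
  · obtain rfl : s = i := hi
    exact of_mul_of_comp (k := k) (show Q.IsPath s [] s from rfl) h
  · exact of_mul_of_ne fun e => hi e.symm

theorem coef_vertex_mul (p : Q.Path) (i : Fin n) (f : PathAlg k Q) :
    coef p (of k (Path.vertex Q i) * f) = if p.target = i then coef p f else 0 := by
  have h : coef p ∘ₗ LinearMap.mulLeft k (of k (Path.vertex Q i)) =
      if p.target = i then coef p else 0 := by
    refine hom_ext fun q => ?_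
    rw [LinearMap.comp_apply, LinearMap.mulLeft_apply, vertex_mul_of]
    by_cases hqp : q = p
    · subst hqp; split_ifs <;> simp
    · split_ifs <;> simp [coef_of, hqp]
  have := LinearMap.congr_fun h f
  split_ifs at this ⊢ <;> exact this

theorem coef_mul_vertex (p : Q.Path) (i : Fin n) (f : PathAlg k Q) :
    coef p (f * of k (Path.vertex Q i)) = if p.source = i then coef p f else 0 := by
  have h : coef p ∘ₗ LinearMap.mulRight k (of k (Path.vertex Q i)) =
      if p.source = i then coef p else 0 := by
    refine hom_ext fun q => ?_
    rw [LinearMap.comp_apply, LinearMap.mulRight_apply, of_mul_vertex]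
    by_cases hqp : q = p
    · subst hqp; split_ifs <;> simp
    · split_ifs <;> simp [coef_of, hqp]
  have := LinearMap.congr_fun h f
  split_ifs at this ⊢ <;> exact this

theorem vertex_mul_arrow_mul_vertex (a : Q.Arr) :
    of k (Path.vertex Q (Q.tgt a)) * of k (Path.arrow Q a) * of k (Path.vertex Q (Q.src a)) =
      of k (Path.arrow Q a) := by
  have h : of k (Path.vertex Q (Q.tgt a)) * of k (Path.arrow Q a) = of k (Path.arrow Q a) :=
    (vertex_mul_of _ _).trans (if_pos rfl)
  rw [h]
  exact (of_mul_vertex _ _).trans (if_pos rfl)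

theorem exists_of_eq_mul_of_infix {p r : Q.Path} (hr : r.arrows ≠ [])
    (h : r.arrows <:+: p.arrows) :
    ∃ u v : Q.Path, of k p = of k v * of k r * of k u := by
  obtain ⟨i, j, l, hl⟩ := p
  obtain ⟨i', j', l', hl'⟩ := r
  obtain ⟨u, v, rfl⟩ : ∃ u v, u ++ l' ++ v = l := h
  obtain ⟨m', h12, hv⟩ := Q.isPath_append.1 hl
  obtain ⟨m, hu, h2⟩ := Q.isPath_append.1 h12
  obtain ⟨a, l'', rfl⟩ := List.exists_cons_of_ne_nil hr
  obtain rfl : i' = m := hl'.1.symm.trans h2.1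
  obtain rfl : j' = m' := hl'.target_unique h2
  refine ⟨⟨i, i', u, hu⟩, ⟨j', j, v, hv⟩, ?_⟩
  rw [mul_assoc, of_mul_of_comp, of_mul_of_comp]

/-- The algebra homomorphism given by a unital linear map that is multiplicative on paths. -/
def algHomOfPaths {R : Type*} [Ring R] [Algebra k R] (φ : PathAlg k Q →ₗ[k] R) (h_one : φ 1 = 1)
    (h_mul : ∀ p q : Q.Path, φ (of k p * of k q) = φ (of k p) * φ (of k q)) :
    PathAlg k Q →ₐ[k] R :=
  AlgHom.ofLinearMap φ h_one fun f g => by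
    have h : (LinearMap.mul k (PathAlg k Q)).compr₂ φ = (LinearMap.mul k R).compl₁₂ φ φ :=
      hom_ext fun p => hom_ext fun q => h_mul p q
    exact LinearMap.congr_fun₂ h f g

theorem leibniz_hom_ext {R : Type*} [Ring R] [Algebra k R] (φ : PathAlg k Q →ₐ[k] R)
    {D D' : PathAlg k Q →ₗ[k] R} (hD : ∀ f g, D (f * g) = D f * φ g + φ f * D g)
    (hD' : ∀ f g, D' (f * g) = D' f * φ g + φ f * D' g)
    (h_vertex : ∀ i, D (of k (Path.vertex Q i)) = D' (of k (Path.vertex Q i)))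
    (h_arrow : ∀ a, D (of k (Path.arrow Q a)) = D' (of k (Path.arrow Q a))) : D = D' := by
  refine hom_ext fun ⟨i, j, l, h⟩ => ?_
  induction l generalizing i with
  | nil => obtain rfl : i = j := h; exact h_vertex i
  | cons a l ih => rw [of_cons, hD, hD', ih, h_arrow]

end PathAlg

/-! ### The combinatorial complex in coordinates -/

namespace MonomialQuiver

open FinQuiver PathAlg

variable {n : ℕ} {k : Type*} [Field k] {Q : MonomialQuiver.{u} n}

theorem pairs_hom_ext {T M : Type*} [AddCommGroup M] [Module k M]
    {φ ψ : (T × Q.Path →₀ k) →ₗ[k] M}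
    (h : ∀ t p, φ (Finsupp.single (t, p) 1) = ψ (Finsupp.single (t, p) 1)) : φ = ψ :=
  Finsupp.lhom_ext' fun tp => LinearMap.ext_ring (h tp.1 tp.2)

theorem coef_val {T : Type*} (t : T) (p : Q.Path) (x : T × Q.Path →₀ k) :
    coef p (Q.val k t x) = x (t, p) := by
  have h : coef p ∘ₗ Q.val k t = Finsupp.lapply (t, p) := by
    refine pairs_hom_ext fun u q => ?_
    rw [LinearMap.comp_apply, val_single, Finsupp.lapply_apply, Finsupp.single_apply]
    split_ifs with hu hup hup <;> simp_all [coef_of]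
  exact LinearMap.congr_fun h x

theorem coef_trunc (p : Q.Path) (f : PathAlg k Q.toFinQuiver) :
    coef p (Q.trunc k f) = if IsBasic p then coef p f else 0 := by
  have h : coef p ∘ₗ Q.trunc k = if IsBasic p then coef p else 0 := by
    refine hom_ext fun q => ?_
    rw [LinearMap.comp_apply, trunc_of]
    by_cases hqp : q = p
    · subst hqp; split_ifs <;> simp
    · split_ifs <;> simp [coef_of, hqp]
  have := LinearMap.congr_fun h f
  split_ifs at this ⊢ <;> exact this

theorem mem_supported_iff_val {S : Set (Q.Arr × Q.Path)} {x : Q.Arr × Q.Path →₀ k} :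
    x ∈ Finsupp.supported k k S ↔ ∀ a, Q.val k a x ∈ spanOf k {p | (a, p) ∈ S} := by
  simp only [Finsupp.mem_supported', Prod.forall, mem_spanOf_iff, Set.mem_ofPred_eq, coef_val]

theorem mem_C1_iff_val {x : Q.Arr × Q.Path →₀ k} :
    x ∈ Q.C1 k ↔ ∀ a, Q.val k a x ∈ spanOf k
      {p : Q.Path | IsBasic p ∧ p.source = Q.src a ∧ p.target = Q.tgt a} :=
  mem_supported_iff_val

theorem val_sum_pair (F : Q.Arr → PathAlg k Q.toFinQuiver) (a : Q.Arr) :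
    Q.val k a (∑ b, Q.pair k b (F b)) = F a := by
  simp only [map_sum, val_pair, Finset.sum_ite_eq', Finset.mem_univ, if_true]

theorem trunc_eq_self {S : Set Q.Path} (hS : ∀ p ∈ S, IsBasic p) {f : PathAlg k Q.toFinQuiver}
    (hf : f ∈ spanOf k S) : Q.trunc k f = f := by
  refine ext_coef fun p => ?_
  rw [coef_trunc]
  split_ifs with hp
  · rfl
  · exact (mem_spanOf_iff.1 hf p fun h => hp (hS p h)).symm

theorem trunc_val {x : Q.Arr × Q.Path →₀ k} (hx : x ∈ Q.C1 k) (a : Q.Arr) :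
    Q.trunc k (Q.val k a x) = Q.val k a x :=
  trunc_eq_self (fun _ h => h.1) (mem_C1_iff_val.1 hx a)

theorem trunc_corner_mem_spanOf (i j : Fin n) (f : PathAlg k Q.toFinQuiver) :
    Q.trunc k (of k (Path.vertex Q.toFinQuiver j) * f * of k (Path.vertex Q.toFinQuiver i)) ∈
      spanOf k {p : Q.Path | IsBasic p ∧ p.source = i ∧ p.target = j} := by
  refine mem_spanOf_iff.2 fun p hp => ?_
  rw [coef_trunc, coef_mul_vertex, coef_vertex_mul]
  split_ifs with hb hi hj
  · exact absurd ⟨hb, hi, hj⟩ hp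
  all_goals rfl

theorem delta1_eq (x : Q.Arr × Q.Path →₀ k) : Q.delta1 k x =
    ∑ r ∈ Q.rel_finite.toFinset, Q.pair k r (Q.trunc k (Q.subst k x (of k r))) := by
  have h : Q.delta1 k = ∑ r ∈ Q.rel_finite.toFinset,
      Q.pair k r ∘ₗ Q.trunc k ∘ₗ (Q.subst k).flip (of k r) := by
    refine pairs_hom_ext fun a γ => ?_
    simp only [delta1, Finsupp.linearCombination_single, one_smul, LinearMap.sum_apply,
      LinearMap.comp_apply, LinearMap.flip_apply, subst_single_of, replace]
  simp only [h, LinearMap.sum_apply, LinearMap.comp_apply, LinearMap.flip_apply]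

theorem mem_kerDelta1_iff {x : Q.Arr × Q.Path →₀ k} :
    x ∈ Q.kerDelta1 k ↔
      x ∈ Q.C1 k ∧ ∀ r ∈ Q.rel, Q.trunc k (Q.subst k x (of k r)) = 0 := by
  refine ⟨fun hx => ⟨hx.1, fun r hr => trunc_subst_rel hx hr⟩,
    fun ⟨hx, h⟩ => ⟨hx, LinearMap.mem_ker.2 ?_⟩⟩
  rw [delta1_eq]
  exact Finset.sum_eq_zero fun r hr => by rw [h r (Q.rel_finite.mem_toFinset.1 hr), map_zero]

theorem trunc_of_rel {r : Q.Path} (hr : r ∈ Q.rel) : Q.trunc k (of k r) = 0 := by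
  rw [trunc_of, if_neg fun h => h r hr List.infix_rfl]

/-! ### The monomial algebra and its derivations -/

theorem trunc_eq_zero_of_mem_relIdeal {f : PathAlg k Q.toFinQuiver} (hf : f ∈ Q.relIdeal k) :
    Q.trunc k f = 0 := by
  rw [relIdeal] at hf
  induction hf using TwoSidedIdeal.span_induction with
  | mem f hf => obtain ⟨r, hr, rfl⟩ := hf; exact trunc_of_rel hr
  | zero => exact map_zero _
  | add f g _ _ hf hg => rw [map_add, hf, hg, add_zero]
  | neg f _ hf => rw [map_neg, hf, neg_zero]
  | left_absorb a f _ hf => rw [← trunc_mul_right, hf, mul_zero, map_zero]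
  | right_absorb a f _ hf => rw [← trunc_mul_left, hf, zero_mul, map_zero]

theorem of_mem_relIdeal {p : Q.Path} (hp : ¬ IsBasic p) : of k p ∈ Q.relIdeal k := by
  simp only [IsBasic, not_forall, not_not] at hp
  obtain ⟨r, hr, hrp⟩ := hp
  have hne : r.arrows ≠ [] := List.ne_nil_of_length_pos (by have := Q.two_le_length r hr; omega)
  obtain ⟨u, v, huv⟩ := exists_of_eq_mul_of_infix (k := k) hne hrp
  rw [huv]
  exact (Q.relIdeal k).mul_mem_right _ _ ((Q.relIdeal k).mul_mem_left _ _
    (TwoSidedIdeal.subset_span ⟨r, hr, rfl⟩))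

variable (k Q) in
/-- The quotient map from the path algebra to the monomial algebra, as an algebra homomorphism. -/
def toAlg : PathAlg k Q.toFinQuiver →ₐ[k] Q.Alg k := Ideal.Quotient.mkₐ k _

theorem mk_eq_toAlg (f : PathAlg k Q.toFinQuiver) :
    (Ideal.Quotient.mk _ f : Q.Alg k) = Q.toAlg k f := rfl

theorem cls_eq_toAlg (p : Q.Path) : Q.cls k p = Q.toAlg k (of k p) := rfl

theorem toAlg_surjective : Function.Surjective (Q.toAlg k) := Ideal.Quotient.mk_surjective

theorem toAlg_trunc (f : PathAlg k Q.toFinQuiver) : Q.toAlg k (Q.trunc k f) = Q.toAlg k f := by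
  have h : (Q.toAlg k).toLinearMap ∘ₗ Q.trunc k = (Q.toAlg k).toLinearMap := by
    refine hom_ext fun p => ?_
    rw [LinearMap.comp_apply, trunc_of]
    split_ifs with hp
    · rfl
    · rw [map_zero]
      exact (Ideal.Quotient.eq_zero_iff_mem.2
        (TwoSidedIdeal.mem_asIdeal.2 (of_mem_relIdeal hp))).symm
  exact LinearMap.congr_fun h f

theorem toAlg_eq_iff {f g : PathAlg k Q.toFinQuiver} :
    Q.toAlg k f = Q.toAlg k g ↔ Q.trunc k f = Q.trunc k g := by
  refine ⟨fun h => ?_, fun h => by rw [← toAlg_trunc f, h, toAlg_trunc]⟩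
  have := trunc_eq_zero_of_mem_relIdeal (TwoSidedIdeal.mem_asIdeal.1 (Ideal.Quotient.eq.1 h))
  rwa [map_sub, sub_eq_zero] at this

variable (k Q) in
/-- The linear section of the quotient map `toAlg` whose image is the span of `ℬ`. -/
def normalForm : Q.Alg k →ₗ[k] PathAlg k Q.toFinQuiver where
  toFun u := Q.trunc k (Function.surjInv toAlg_surjective u)
  map_add' u v := by
    rw [← map_add, ← toAlg_eq_iff, map_add]
    simp only [Function.surjInv_eq]
  map_smul' c u := by
    rw [RingHom.id_apply, ← map_smul, ← toAlg_eq_iff, map_smul]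
    simp only [Function.surjInv_eq]

theorem normalForm_toAlg (f : PathAlg k Q.toFinQuiver) :
    Q.normalForm k (Q.toAlg k f) = Q.trunc k f :=
  toAlg_eq_iff.1 (Function.surjInv_eq toAlg_surjective _)

theorem toAlg_normalForm (u : Q.Alg k) : Q.toAlg k (Q.normalForm k u) = u := by
  obtain ⟨f, rfl⟩ := toAlg_surjective u
  rw [normalForm_toAlg, toAlg_trunc]

/-- The endomorphism of the monomial algebra induced by the substitution of `x(a)` for `a`. -/
def substAlg (x : Q.Arr × Q.Path →₀ k) : Q.Alg k →ₗ[k] Q.Alg k :=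
  (Q.toAlg k).toLinearMap ∘ₗ Q.subst k x ∘ₗ Q.normalForm k

theorem substAlg_toAlg {x : Q.Arr × Q.Path →₀ k} (hx : x ∈ Q.kerDelta1 k)
    (f : PathAlg k Q.toFinQuiver) : substAlg x (Q.toAlg k f) = Q.toAlg k (Q.subst k x f) := by
  change Q.toAlg k (Q.subst k x (Q.normalForm k (Q.toAlg k f))) = _
  rw [normalForm_toAlg, toAlg_eq_iff, trunc_subst_trunc hx]

theorem substAlg_mem_algDer {x : Q.Arr × Q.Path →₀ k} (hx : x ∈ Q.kerDelta1 k) :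
    substAlg x ∈ algDer k (Q.Alg k) := by
  intro u v
  obtain ⟨f, rfl⟩ := toAlg_surjective u
  obtain ⟨g, rfl⟩ := toAlg_surjective v
  simp only [← map_mul, substAlg_toAlg hx, subst_mul hx.1, map_add]

theorem substAlg_br {x y : Q.Arr × Q.Path →₀ k} (hx : x ∈ Q.kerDelta1 k)
    (hy : y ∈ Q.kerDelta1 k) (u : Q.Alg k) :
    substAlg (Q.br k x y) u = substAlg x (substAlg y u) - substAlg y (substAlg x u) := by
  obtain ⟨f, rfl⟩ := toAlg_surjective u
  rw [substAlg_toAlg (br_mem hx hy), substAlg_toAlg hx, substAlg_toAlg hy, substAlg_toAlg hx,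
    substAlg_toAlg hy, ← map_sub, toAlg_eq_iff, map_sub, trunc_subst_br hx hy]

variable (k Q) in
/-- The derivation of the monomial algebra that corresponds to an element of `Ker δ¹`. -/
def derOf : Q.kerDelta1 k →ₗ⁅k⁆ algDer k (Q.Alg k) where
  toFun x := ⟨substAlg x.1, substAlg_mem_algDer x.2⟩
  map_add' x y := algDer_ext fun u => by simp [substAlg]
  map_smul' c x := algDer_ext fun u => by simp [substAlg]
  map_lie' := algDer_ext fun u => substAlg_br (Subtype.property _) (Subtype.property _) u

theorem derOf_toAlg (x : Q.kerDelta1 k) (f : PathAlg k Q.toFinQuiver) :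
    (Q.derOf k x).1 (Q.toAlg k f) = Q.toAlg k (Q.subst k x.1 f) :=
  substAlg_toAlg x.2 f

theorem represents_derOf (x : Q.kerDelta1 k) : Represents k x.1 (Q.derOf k x) := by
  refine ⟨fun i => ?_, fun a => ?_⟩
  · rw [cls_eq_toAlg, derOf_toAlg, subst_vertex _ _ rfl, map_zero]
  · rw [cls_eq_toAlg, derOf_toAlg, subst_arrow x.2.1, mk_eq_toAlg]

theorem Represents.apply_toAlg {x : Q.Arr × Q.Path →₀ k} (hx : x ∈ Q.C1 k)
    {D : algDer k (Q.Alg k)} (hD : Represents k x D) (f : PathAlg k Q.toFinQuiver) :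
    D.1 (Q.toAlg k f) = Q.toAlg k (Q.subst k x f) := by
  have h : D.1 ∘ₗ (Q.toAlg k).toLinearMap = (Q.toAlg k).toLinearMap ∘ₗ Q.subst k x := by
    refine leibniz_hom_ext (Q.toAlg k) (fun f g => ?_) (fun f g => ?_) (fun i => ?_) (fun a => ?_)
    · simp only [LinearMap.comp_apply, AlgHom.toLinearMap_apply, map_mul, algDer_leibniz]
    · simp only [LinearMap.comp_apply, AlgHom.toLinearMap_apply, subst_mul hx, map_add, map_mul]
    · rw [LinearMap.comp_apply, LinearMap.comp_apply, subst_vertex _ _ rfl, map_zero]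
      exact hD.1 i
    · rw [LinearMap.comp_apply, LinearMap.comp_apply, subst_arrow hx]
      exact hD.2 a
  exact LinearMap.congr_fun h f

theorem Represents.mem_kerDelta1 {x : Q.Arr × Q.Path →₀ k} (hx : x ∈ Q.C1 k)
    {D : algDer k (Q.Alg k)} (hD : Represents k x D) : x ∈ Q.kerDelta1 k := by
  refine mem_kerDelta1_iff.2 ⟨hx, fun r hr => ?_⟩
  have h : Q.toAlg k (of k r) = Q.toAlg k 0 := toAlg_eq_iff.2 (by rw [trunc_of_rel hr, map_zero])
  rw [← map_zero (Q.trunc k), ← toAlg_eq_iff, ← hD.apply_toAlg hx, h, map_zero, map_zero]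

theorem Represents.derOf_eq {x : Q.Arr × Q.Path →₀ k} (hx : x ∈ Q.kerDelta1 k)
    {D : algDer k (Q.Alg k)} (hD : Represents k x D) : Q.derOf k ⟨x, hx⟩ = D := by
  refine algDer_ext fun u => ?_
  obtain ⟨f, rfl⟩ := toAlg_surjective u
  rw [derOf_toAlg, hD.apply_toAlg hx.1]

/-- A derivation that kills the vertices preserves the corners `e_j Λ e_i`. -/
theorem normalForm_der_arrow_mem_spanOf {D : algDer k (Q.Alg k)}
    (hD : ∀ i, D.1 (Q.cls k (Path.vertex Q.toFinQuiver i)) = 0) (a : Q.Arr) :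
    Q.normalForm k (D.1 (Q.cls k (Path.arrow Q.toFinQuiver a))) ∈
      spanOf k {p : Q.Path | IsBasic p ∧ p.source = Q.src a ∧ p.target = Q.tgt a} := by
  obtain ⟨f, hf⟩ := toAlg_surjective (D.1 (Q.cls k (Path.arrow Q.toFinQuiver a)))
  have h : D.1 (Q.cls k (Path.arrow Q.toFinQuiver a)) =
      Q.toAlg k (of k (Path.vertex Q.toFinQuiver (Q.tgt a)) * f *
        of k (Path.vertex Q.toFinQuiver (Q.src a))) := by
    rw [map_mul (Q.toAlg k), map_mul (Q.toAlg k), hf]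
    simp only [cls_eq_toAlg] at hD ⊢
    conv_lhs => rw [← vertex_mul_arrow_mul_vertex, map_mul (Q.toAlg k), map_mul (Q.toAlg k),
      algDer_leibniz, algDer_leibniz, hD, hD, zero_mul, zero_add, mul_zero, add_zero]
  rw [h, normalForm_toAlg]
  exact trunc_corner_mem_spanOf _ _ _

theorem exists_derOf_eq {D : algDer k (Q.Alg k)}
    (hD : ∀ i, D.1 (Q.cls k (Path.vertex Q.toFinQuiver i)) = 0) :
    ∃ x : Q.kerDelta1 k, Q.derOf k x = D := by
  set x : Q.Arr × Q.Path →₀ k :=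
    ∑ a, Q.pair k a (Q.normalForm k (D.1 (Q.cls k (Path.arrow Q.toFinQuiver a))))
  have hval (a : Q.Arr) :
      Q.val k a x = Q.normalForm k (D.1 (Q.cls k (Path.arrow Q.toFinQuiver a))) :=
    val_sum_pair _ a
  have hx : x ∈ Q.C1 k := mem_C1_iff_val.2 fun a => by
    rw [hval]
    exact normalForm_der_arrow_mem_spanOf hD a
  have hrep : Represents k x D := ⟨hD, fun a => by rw [hval, mk_eq_toAlg, toAlg_normalForm]⟩
  exact ⟨⟨x, hrep.mem_kerDelta1 hx⟩, hrep.derOf_eq _⟩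

end MonomialQuiver

/-! ### Inner derivations -/

section InnerDerivation

variable {k : Type*} [Field k] {R : Type*} [Ring R] [Algebra k R]

variable (k) in
/-- The inner derivation `x ↦ c x - x c`. -/
def adDer (c : R) : algDer k R :=
  ⟨LinearMap.mulLeft k c - LinearMap.mulRight k c, fun x y => by
    simp only [LinearMap.sub_apply, LinearMap.mulLeft_apply, LinearMap.mulRight_apply]
    noncomm_ring⟩

theorem adDer_apply (c x : R) : (adDer k c).1 x = c * x - x * c := rfl

theorem adDer_mem_innDer (c : R) : adDer k c ∈ innDer k R := ⟨c, fun _ => rfl⟩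

theorem exists_adDer_apply_idempotent_eq {ι : Type*} [Fintype ι] {e : ι → R}
    (he : CompleteOrthogonalIdempotents e) (D : algDer k R) :
    ∃ c : R, ∀ j, D.1 (e j) = (adDer k c).1 (e j) := by
  refine ⟨∑ i, D.1 (e i) * e i, fun j => ?_⟩
  have h_right : (∑ i, D.1 (e i) * e i) * e j = D.1 (e j) * e j := by
    simp only [Finset.sum_mul, mul_assoc, he.mul_eq, mul_ite, mul_zero, Finset.sum_ite_eq',
      Finset.mem_univ, if_true]
  have h_left : e j * ∑ i, D.1 (e i) * e i = D.1 (e j) * e j - D.1 (e j) :=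
    calc e j * ∑ i, D.1 (e i) * e i = ∑ i, (D.1 (e j * e i) * e i - D.1 (e j) * e i) := by
          rw [Finset.mul_sum]
          refine Finset.sum_congr rfl fun i _ => ?_
          rw [algDer_leibniz, add_mul, mul_assoc, (he.idem i).eq, mul_assoc, add_sub_cancel_left]
      _ = D.1 (e j) * e j - D.1 (e j) := by
          rw [Finset.sum_sub_distrib, ← Finset.mul_sum, he.complete, mul_one]
          simp only [he.mul_eq, apply_ite D.1, map_zero, ite_mul, zero_mul, Finset.sum_ite_eq,
            Finset.mem_univ, if_true]
  rw [adDer_apply, h_right, h_left, sub_sub_cancel]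

end InnerDerivation

namespace PathAlg

open FinQuiver

variable {n : ℕ} {k : Type*} [Field k] {Q : FinQuiver.{u} n}

variable (k Q) in
theorem completeOrthogonalIdempotents_vertex :
    CompleteOrthogonalIdempotents fun i => of k (Path.vertex Q i) :=
  CompleteOrthogonalIdempotents.iff_ortho_complete.2
    ⟨fun _ _ hij => of_mul_of_ne hij.symm, one_def.symm⟩

theorem of_mul_of_mem_spanOf (p q : Q.Path) :
    of k p * of k q ∈ spanOf k {r : Q.Path | r.arrows = q.arrows ++ p.arrows} := by
  obtain ⟨i, j, l, hl⟩ := p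
  obtain ⟨i', j', l', hl'⟩ := q
  by_cases h : j' = i
  · subst h
    rw [of_mul_of_comp]
    exact of_mem_spanOf rfl
  · rw [of_mul_of_ne h]
    exact Submodule.zero_mem _

theorem coef_arrow_mul {p : Q.Path} (hp : p.arrows.length ≤ 1) (a : Q.Arr) (f : PathAlg k Q) :
    coef p (of k (Path.arrow Q a) * f) =
      if Path.arrow Q a = p then coef (Path.vertex Q (Q.src a)) f else 0 := by
  have h : coef p ∘ₗ LinearMap.mulLeft k (of k (Path.arrow Q a)) =
      (coef (Path.vertex Q (Q.src a))).smulRight (coef p (of k (Path.arrow Q a))) := by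
    refine hom_ext fun q => ?_
    rw [LinearMap.comp_apply, LinearMap.mulLeft_apply, LinearMap.smulRight_apply, coef_of _ q]
    by_cases hq : q.arrows = []
    · rw [Path.eq_vertex hq, of_mul_vertex]
      simp only [Path.vertex_inj, Path.arrow, eq_comm (a := Q.src a)]
      split_ifs <;> simp
    · rw [if_neg fun e => hq (congrArg Path.arrows e), zero_smul]
      exact mem_spanOf_iff.1 (of_mul_of_mem_spanOf _ _) p fun e => by
        have := List.length_pos_iff.2 hq
        rw [e, List.length_append] at hp
        simp only [Path.arrow, List.length_singleton] at hp
        omega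
  have := LinearMap.congr_fun h f
  rw [LinearMap.comp_apply, LinearMap.mulLeft_apply, LinearMap.smulRight_apply, coef_of] at this
  simpa using this

theorem coef_mul_arrow {p : Q.Path} (hp : p.arrows.length ≤ 1) (a : Q.Arr) (f : PathAlg k Q) :
    coef p (f * of k (Path.arrow Q a)) =
      if Path.arrow Q a = p then coef (Path.vertex Q (Q.tgt a)) f else 0 := by
  have h : coef p ∘ₗ LinearMap.mulRight k (of k (Path.arrow Q a)) =
      (coef (Path.vertex Q (Q.tgt a))).smulRight (coef p (of k (Path.arrow Q a))) := by
    refine hom_ext fun q => ?_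
    rw [LinearMap.comp_apply, LinearMap.mulRight_apply, LinearMap.smulRight_apply, coef_of _ q]
    by_cases hq : q.arrows = []
    · rw [Path.eq_vertex hq, vertex_mul_of]
      simp only [Path.vertex_inj, Path.arrow, eq_comm (a := Q.tgt a)]
      split_ifs <;> simp
    · rw [if_neg fun e => hq (congrArg Path.arrows e), zero_smul]
      exact mem_spanOf_iff.1 (of_mul_of_mem_spanOf _ _) p fun e => by
        have := List.length_pos_iff.2 hq
        rw [e, List.length_append] at hp
        simp only [Path.arrow, List.length_singleton] at hp
        omega
  have := LinearMap.congr_fun h f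
  rw [LinearMap.comp_apply, LinearMap.mulRight_apply, LinearMap.smulRight_apply, coef_of] at this
  simpa using this

end PathAlg

namespace MonomialQuiver

open FinQuiver PathAlg

variable {n : ℕ} {k : Type*} [Field k] {Q : MonomialQuiver.{u} n}

theorem exists_adDer_vertex_eq (D : algDer k (Q.Alg k)) :
    ∃ c : Q.Alg k, ∀ i, D.1 (Q.cls k (Path.vertex Q.toFinQuiver i)) =
      (adDer k c).1 (Q.cls k (Path.vertex Q.toFinQuiver i)) :=
  exists_adDer_apply_idempotent_eq
    ((completeOrthogonalIdempotents_vertex k Q.toFinQuiver).map (Q.toAlg k).toRingHom) D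

/-! ### The image of `δ⁰` -/

theorem of_arrow_mul_of (a : Q.Arr) (p : Q.Path) :
    of k (Path.arrow Q.toFinQuiver a) * of k p = if Q.src a = p.target then
      pathOrZero k Q.toFinQuiver p.source (p.arrows ++ [a]) (Q.tgt a) else 0 := by
  rw [of_mul_of, mulPath]
  exact if_congr eq_comm rfl rfl

theorem of_mul_of_arrow (a : Q.Arr) (p : Q.Path) :
    of k p * of k (Path.arrow Q.toFinQuiver a) = if Q.tgt a = p.source then
      pathOrZero k Q.toFinQuiver (Q.src a) (a :: p.arrows) p.target else 0 := by
  rw [of_mul_of, mulPath]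
  rfl

variable (Q) in
/-- The oriented cycles in `ℬ`, including the vertices. -/
def cyclicBasic : Set Q.Path := {p | IsBasic p ∧ p.source = p.target}

variable (k Q) in
/-- The linear map `f ↦ ∑_a a//(a f - f a)`, which is `δ⁰` in terms of the oriented cycles. -/
def arrowCommutators : PathAlg k Q.toFinQuiver →ₗ[k] (Q.Arr × Q.Path →₀ k) :=
  ∑ a, Q.pair k a ∘ₗ Q.trunc k ∘ₗ (LinearMap.mulLeft k (of k (Path.arrow Q.toFinQuiver a)) -
    LinearMap.mulRight k (of k (Path.arrow Q.toFinQuiver a)))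

theorem val_arrowCommutators (f : PathAlg k Q.toFinQuiver) (a : Q.Arr) :
    Q.val k a (Q.arrowCommutators k f) = Q.trunc k
      (of k (Path.arrow Q.toFinQuiver a) * f - f * of k (Path.arrow Q.toFinQuiver a)) := by
  rw [arrowCommutators, LinearMap.sum_apply]
  exact val_sum_pair _ a

theorem delta0_single {i : Fin n} {p : Q.Path} (hs : p.source = i) (ht : p.target = i) :
    Q.delta0 k (Finsupp.single (i, p) 1) = Q.arrowCommutators k (of k p) := by
  refine val_ext fun a => ?_
  rw [val_arrowCommutators, delta0, Finsupp.linearCombination_single, one_smul, map_sub, map_sum,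
    map_sum, of_arrow_mul_of, of_mul_of_arrow, map_sub, hs, ht]
  simp only [apply_ite (Q.val k a), apply_ite (Q.trunc k), val_pair, map_zero]
  congr 1
  · rw [Finset.sum_eq_single a (fun b _ hb => by simp [hb]) (by simp)]
    simp
  · rw [Finset.sum_eq_single a (fun b _ hb => by simp [hb]) (by simp)]
    simp

theorem imDelta0_eq_map :
    Q.imDelta0 k = (spanOf k Q.cyclicBasic).map (Q.arrowCommutators k) := by
  refine le_antisymm ?_ (map_spanOf_le fun p hp => ?_)
  · rw [imDelta0, C0, Finsupp.supported_eq_span_single, Submodule.map_span, Submodule.span_le]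
    rintro _ ⟨_, ⟨⟨i, p⟩, ⟨hb, hs, ht⟩, rfl⟩, rfl⟩
    exact ⟨of k p, of_mem_spanOf ⟨hb, hs.trans ht.symm⟩, (delta0_single hs ht).symm⟩
  · exact ⟨Finsupp.single (p.source, p) 1,
      Finsupp.single_mem_supported k 1 ⟨hp.1, rfl, hp.2.symm⟩, delta0_single rfl hp.2.symm⟩

theorem vertex_mul_comm_of_mem_spanOf {f : PathAlg k Q.toFinQuiver}
    (hf : f ∈ spanOf k Q.cyclicBasic) (i : Fin n) :
    of k (Path.vertex Q.toFinQuiver i) * f = f * of k (Path.vertex Q.toFinQuiver i) := by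
  refine ext_coef fun p => ?_
  rw [coef_vertex_mul, coef_mul_vertex]
  by_cases hp : p ∈ Q.cyclicBasic
  · rw [hp.2]
  · rw [mem_spanOf_iff.1 hf p hp, ite_self, ite_self]

theorem arrowCommutators_mem_C1 {f : PathAlg k Q.toFinQuiver}
    (hf : f ∈ spanOf k Q.cyclicBasic) : Q.arrowCommutators k f ∈ Q.C1 k := by
  refine mem_C1_iff_val.2 fun a => ?_
  set s := of k (Path.vertex Q.toFinQuiver (Q.src a))
  set t := of k (Path.vertex Q.toFinQuiver (Q.tgt a))
  set α := of k (Path.arrow Q.toFinQuiver a)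
  have hα : t * α * s = α := vertex_mul_arrow_mul_vertex a
  have hs : s * f = f * s := vertex_mul_comm_of_mem_spanOf hf _
  have ht : t * f = f * t := vertex_mul_comm_of_mem_spanOf hf _
  have h : α * f - f * α = t * (α * f - f * α) * s :=
    calc α * f - f * α = t * α * (s * f) - f * t * α * s := by
          rw [← mul_assoc, hα, mul_assoc f, mul_assoc f, hα]
      _ = t * (α * f - f * α) * s := by rw [hs, ← ht]; noncomm_ring
  rw [val_arrowCommutators, h]
  exact trunc_corner_mem_spanOf _ _ _

theorem represents_arrowCommutators {f : PathAlg k Q.toFinQuiver}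
    (hf : f ∈ spanOf k Q.cyclicBasic) :
    Represents k (Q.arrowCommutators k f) (adDer k (Q.toAlg k (-f))) := by
  refine ⟨fun i => ?_, fun a => ?_⟩
  · rw [adDer_apply, cls_eq_toAlg, ← map_mul, ← map_mul, ← map_sub, neg_mul, mul_neg,
      vertex_mul_comm_of_mem_spanOf hf, sub_self, map_zero]
  · rw [adDer_apply, cls_eq_toAlg, ← map_mul, ← map_mul, ← map_sub, mk_eq_toAlg,
      val_arrowCommutators, toAlg_trunc, neg_mul, mul_neg, neg_sub_neg]

theorem imDelta0_le_kerDelta1 : Q.imDelta0 k ≤ Q.kerDelta1 k := by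
  rw [imDelta0_eq_map]
  rintro _ ⟨f, hf, rfl⟩
  exact (represents_arrowCommutators hf).mem_kerDelta1 (arrowCommutators_mem_C1 hf)

theorem normalForm_mem_spanOf_cyclicBasic {c : Q.Alg k}
    (hc : ∀ i, (adDer k c).1 (Q.cls k (Path.vertex Q.toFinQuiver i)) = 0) :
    Q.normalForm k c ∈ spanOf k Q.cyclicBasic := by
  obtain ⟨f, rfl⟩ := toAlg_surjective c
  rw [normalForm_toAlg]
  refine mem_spanOf_iff.2 fun p hp => ?_
  have h : Q.toAlg k (f * of k (Path.vertex Q.toFinQuiver p.source)) =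
      Q.toAlg k (of k (Path.vertex Q.toFinQuiver p.source) * f) := by
    rw [map_mul, map_mul]
    exact (sub_eq_zero.1 (hc p.source))
  have h_coef := congrArg (coef p) (toAlg_eq_iff.1 h)
  rw [coef_trunc, coef_trunc, coef_mul_vertex, coef_vertex_mul, if_pos rfl] at h_coef
  rw [coef_trunc, h_coef, ite_eq_right_iff, ite_eq_right_iff]
  exact fun hb ht => absurd ⟨hb, ht.symm⟩ hp

theorem derOf_mem_innDer_iff (x : Q.kerDelta1 k) :
    Q.derOf k x ∈ innDer k (Q.Alg k) ↔ x.1 ∈ Q.imDelta0 k := by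
  rw [imDelta0_eq_map]
  constructor
  · rintro ⟨c, hc⟩
    have hx := represents_derOf x
    have hc' := normalForm_mem_spanOf_cyclicBasic (c := c) fun i =>
      (hc _).symm.trans (hx.1 i)
    refine ⟨-Q.normalForm k c, Submodule.neg_mem _ hc', val_ext fun a => ?_⟩
    rw [← trunc_val x.2.1, val_arrowCommutators, ← toAlg_eq_iff, ← mk_eq_toAlg (Q.val k a x.1),
      ← hx.2 a, hc, map_sub, map_mul, map_mul, map_neg, toAlg_normalForm, ← cls_eq_toAlg, mul_neg,
      neg_mul, neg_sub_neg]
  · rintro ⟨f, hf, hfx⟩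
    have hrep := represents_arrowCommutators hf
    rw [hfx] at hrep
    rw [hrep.derOf_eq x.2]
    exact adDer_mem_innDer _

variable (k Q) in
/-- The projection of `Ker δ¹` onto the first Hochschild cohomology. -/
def toHH1 : Q.kerDelta1 k →ₗ⁅k⁆ HH1 k (Q.Alg k) where
  toFun x := LieSubmodule.Quotient.mk (Q.derOf k x)
  map_add' x y := by rw [map_add]; rfl
  map_smul' c x := by rw [map_smul]; rfl
  map_lie' := by intro x y; rw [LieHom.map_lie]; rfl

theorem toHH1_eq_zero_iff (x : Q.kerDelta1 k) : Q.toHH1 k x = 0 ↔ x.1 ∈ Q.imDelta0 k := by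
  rw [← derOf_mem_innDer_iff]
  exact LieSubmodule.Quotient.mk_eq_zero'

theorem toHH1_surjective : Function.Surjective (Q.toHH1 k) := by
  intro u
  obtain ⟨D, rfl⟩ := LieSubmodule.Quotient.surjective_mk' _ u
  obtain ⟨c, hc⟩ := exists_adDer_vertex_eq D
  obtain ⟨x, hx⟩ := exists_derOf_eq (D := D - adDer k c) fun i => sub_eq_zero.2 (hc i)
  refine ⟨x, ?_⟩
  change LieSubmodule.Quotient.mk' (innDer k (Q.Alg k)) (Q.derOf k x) = _
  rw [← sub_eq_zero, ← map_sub, hx, LieSubmodule.Quotient.mk_eq_zero, sub_sub_cancel_left]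
  exact Submodule.neg_mem _ (adDer_mem_innDer c)

theorem isBasic_arrow (a : Q.Arr) : IsBasic (Path.arrow Q.toFinQuiver a : Q.Path) := by
  intro r hr h
  have h_le := h.length_le
  have h_two := Q.two_le_length r hr
  simp only [Path.arrow, List.length_singleton] at h_le
  omega

theorem arrowCommutators_mem_supported_iff {f : PathAlg k Q.toFinQuiver} :
    Q.arrowCommutators k f ∈
        Finsupp.supported k k {ap : Q.Arr × Q.Path | 2 ≤ ap.2.arrows.length} ↔
      ∀ a, coef (Path.vertex Q.toFinQuiver (Q.src a)) f =
        coef (Path.vertex Q.toFinQuiver (Q.tgt a)) f := by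
  rw [mem_supported_iff_val]
  refine forall_congr' fun a => ?_
  rw [val_arrowCommutators, mem_spanOf_iff]
  constructor
  · intro h
    have ha := h (Path.arrow Q.toFinQuiver a) (by simp [Path.arrow])
    rwa [coef_trunc, if_pos (isBasic_arrow a), map_sub, coef_arrow_mul (by simp [Path.arrow]),
      coef_mul_arrow (by simp [Path.arrow]), if_pos rfl, if_pos rfl, sub_eq_zero] at ha
  · intro h p hp
    have hp' : p.arrows.length ≤ 1 := Nat.lt_succ_iff.1 (not_le.1 hp)
    rw [coef_trunc, map_sub, coef_arrow_mul hp', coef_mul_arrow hp', h, sub_self, ite_self]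

theorem arrow_commutator_of_isDirected (hQ : Q.IsDirected) {f : PathAlg k Q.toFinQuiver}
    (hf : f ∈ spanOf k Q.cyclicBasic) (a : Q.Arr) :
    of k (Path.arrow Q.toFinQuiver a) * f - f * of k (Path.arrow Q.toFinQuiver a) =
      (coef (Path.vertex Q.toFinQuiver (Q.src a)) f -
        coef (Path.vertex Q.toFinQuiver (Q.tgt a)) f) • of k (Path.arrow Q.toFinQuiver a) := by
  have h : Set.EqOn
      (LinearMap.mulLeft k (of k (Path.arrow Q.toFinQuiver a)) -
        LinearMap.mulRight k (of k (Path.arrow Q.toFinQuiver a)))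
      (LinearMap.smulRight
        (coef (Path.vertex Q.toFinQuiver (Q.src a)) - coef (Path.vertex Q.toFinQuiver (Q.tgt a)) :
          PathAlg k Q.toFinQuiver →ₗ[k] k)
        (of k (Path.arrow Q.toFinQuiver a))) (of k '' Q.cyclicBasic) := by
    rintro _ ⟨⟨i, j, l, hl⟩, ⟨-, hp⟩, rfl⟩
    obtain rfl : i = j := hp
    obtain rfl := hQ.eq_nil_of_isPath hl
    change of k _ * of k (Path.vertex Q.toFinQuiver i) -
      of k (Path.vertex Q.toFinQuiver i) * of k _ =
        (coef _ (of k (Path.vertex Q.toFinQuiver i)) -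
          coef _ (of k (Path.vertex Q.toFinQuiver i))) • _
    rw [of_mul_vertex, vertex_mul_of, coef_of, coef_of, Path.vertex_inj, Path.vertex_inj, sub_smul,
      ite_smul, ite_smul, one_smul, zero_smul]
    simp only [Path.arrow, eq_comm (a := i)]
    congr!
  exact LinearMap.eqOn_span h hf

theorem arrowCommutators_eq_zero_iff (hQ : Q.IsDirected) {f : PathAlg k Q.toFinQuiver}
    (hf : f ∈ spanOf k Q.cyclicBasic) :
    Q.arrowCommutators k f = 0 ↔ ∀ a, coef (Path.vertex Q.toFinQuiver (Q.src a)) f =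
      coef (Path.vertex Q.toFinQuiver (Q.tgt a)) f := by
  refine ⟨fun h => arrowCommutators_mem_supported_iff.1 (h ▸ Submodule.zero_mem _),
    fun h => val_ext fun a => ?_⟩
  rw [val_arrowCommutators, arrow_commutator_of_isDirected hQ hf, h, sub_self, zero_smul, map_zero,
    map_zero]

end MonomialQuiver

/-! ### Paths of the dual extension -/

namespace MonomialQuiver

open FinQuiver PathAlg

variable {n : ℕ} {k : Type*} [Field k] {B A : MonomialQuiver.{u} n}

theorem exists_arrB_or_arrA (c : (dualExt B A).Arr) :
    (∃ b, c = arrB B A b) ∨ ∃ a, c = arrA B A a :=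
  match c with
  | Sum.inl b => Or.inl ⟨b, rfl⟩
  | Sum.inr a => Or.inr ⟨a, rfl⟩

theorem arrB_injective : Function.Injective (arrB B A) := Sum.inl_injective

theorem arrA_ne_arrB (a : A.op.Arr) (b : B.Arr) : arrA B A a ≠ arrB B A b := Sum.inr_ne_inl

theorem arrA_notMem_map_arrB (a : A.op.Arr) (l : List B.Arr) : arrA B A a ∉ l.map (arrB B A) := by
  intro h
  obtain ⟨b, -, hb⟩ := List.mem_map.1 h
  exact arrA_ne_arrB a b hb.symm

theorem pathB_injective : Function.Injective (pathB B A) := inl_injective _ _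

theorem pathB_mem_rel {r : B.Path} (hr : r ∈ B.rel) : pathB B A r ∈ (dualExt B A).rel :=
  Or.inl (Or.inl ⟨r, hr, rfl⟩)

theorem isPath_map_arrB {l : List B.Arr} {i j : Fin n} :
    (dualExt B A).IsPath i (l.map (arrB B A)) j ↔ B.IsPath i l j := by
  induction l generalizing i with
  | nil => exact Iff.rfl
  | cons b l ih => exact and_congr Iff.rfl ih

theorem le_of_isPath_map_arrA (hA : A.IsDirected) {m : List A.op.Arr} {i j : Fin n}
    (h : (dualExt B A).IsPath i (m.map (arrA B A)) j) : j ≤ i := by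
  induction m generalizing i with
  | nil => exact le_of_eq (Eq.symm h)
  | cons a m ih =>
    obtain ⟨rfl, h⟩ := h
    exact (ih h).trans (hA a).le

theorem mem_range_pathB {p : (dualExt B A).Path} :
    p ∈ Set.range (pathB B A) ↔ ∃ l : List B.Arr, p.arrows = l.map (arrB B A) := by
  constructor
  · rintro ⟨q, rfl⟩
    exact ⟨q.arrows, rfl⟩
  · obtain ⟨i, j, _, h⟩ := p
    rintro ⟨l, rfl⟩
    exact ⟨⟨i, j, l, isPath_map_arrB.1 h⟩, rfl⟩

theorem isBasic_pathB {q : B.Path} : IsBasic (pathB B A q) ↔ IsBasic q := by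
  constructor
  · intro h r hr hrq
    exact h (pathB B A r) (pathB_mem_rel hr) (hrq.map (arrB B A))
  · rintro h _ ((⟨r, hr, rfl⟩ | ⟨r, hr, rfl⟩) | ⟨b, a, h', rfl⟩) hrq
    · exact h r hr (map_infix_map Sum.inl_injective hrq)
    · obtain ⟨a, l, hl⟩ := List.exists_cons_of_length_pos
        (zero_lt_two.trans_le (A.op.two_le_length r hr))
      exact arrA_notMem_map_arrB a q.arrows
        (hrq.subset (List.mem_map.2 ⟨a, hl ▸ List.mem_cons_self, rfl⟩))
    · exact arrA_notMem_map_arrB a q.arrows (hrq.subset List.mem_cons_self)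

theorem not_isBasic_of_arrA_arrB_infix {p : (dualExt B A).Path} {a : A.op.Arr} {b : B.Arr}
    (h : [arrA B A a, arrB B A b] <:+: p.arrows) : ¬ IsBasic p := by
  intro hp
  obtain ⟨i, j, _, hL⟩ := p
  obtain ⟨s, t, rfl⟩ := h
  obtain ⟨_, h_init, -⟩ := (dualExt B A).isPath_append.1 hL
  obtain ⟨_, -, -, h_eq, -⟩ := (dualExt B A).isPath_append.1 h_init
  exact hp (mixedRel B.toFinQuiver A.op.toFinQuiver b a h_eq.symm) (Or.inr ⟨b, a, _, rfl⟩)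
    ⟨s, t, rfl⟩

theorem exists_eq_append_of_isBasic {p : (dualExt B A).Path} (hp : IsBasic p) :
    ∃ (l : List B.Arr) (m : List A.op.Arr),
      p.arrows = l.map (arrB B A) ++ m.map (arrA B A) := by
  have h_infix (a : A.op.Arr) (b : B.Arr) : ¬ [arrA B A a, arrB B A b] <:+: p.arrows :=
    fun h => not_isBasic_of_arrA_arrB_infix h hp
  generalize p.arrows = L at h_infix
  induction L with
  | nil => exact ⟨[], [], rfl⟩
  | cons c L ih =>
    obtain ⟨l, m, rfl⟩ := ih fun a b h => h_infix a b (h.trans (List.suffix_cons _ _).isInfix)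
    rcases exists_arrB_or_arrA c with ⟨b, rfl⟩ | ⟨a, rfl⟩
    · exact ⟨b :: l, m, rfl⟩
    · cases l with
      | nil => exact ⟨[], a :: m, rfl⟩
      | cons b l => exact absurd (List.prefix_append [_, _] _).isInfix (h_infix a b)

theorem exists_eq_cons_append (hA : A.IsDirected) (hB : B.IsDirected) {p : (dualExt B A).Path}
    (hp : IsBasic p) {b : B.Arr} (hs : p.source = B.src b) (ht : p.target = B.tgt b) :
    ∃ (b' : B.Arr) (l : List B.Arr) (m : List A.op.Arr),
      p.arrows = (b' :: l).map (arrB B A) ++ m.map (arrA B A) := by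
  obtain ⟨l, m, h⟩ := exists_eq_append_of_isBasic hp
  cases l with
  | nil =>
    have h_le : p.target ≤ p.source := le_of_isPath_map_arrA hA (h ▸ p.isPath)
    rw [hs, ht] at h_le
    exact absurd h_le (hB b).not_ge
  | cons b' l => exact ⟨b', l, m, h⟩

theorem isMixed_of_notMem_range_pathB (hA : A.IsDirected) (hB : B.IsDirected)
    {p : (dualExt B A).Path} (hp : IsBasic p) {b : B.Arr} (hs : p.source = B.src b)
    (ht : p.target = B.tgt b) (h : p ∉ Set.range (pathB B A)) : IsMixed p := by
  obtain ⟨b', l, m, hlm⟩ := exists_eq_cons_append hA hB hp hs ht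
  refine ⟨b' :: l, m, List.cons_ne_nil _ _, ?_, hlm⟩
  rintro rfl
  exact h (mem_range_pathB.2 ⟨b' :: l, by rw [hlm, List.map_nil, List.append_nil]⟩)

theorem IsMixed.notMem_range_pathB {p : (dualExt B A).Path} (hp : IsMixed p) :
    p ∉ Set.range (pathB B A) := by
  obtain ⟨l, m, -, hm, hlm⟩ := hp
  obtain ⟨a, m', rfl⟩ := List.exists_cons_of_ne_nil hm
  rintro ⟨q, rfl⟩
  exact arrA_notMem_map_arrB a q.arrows
    (hlm ▸ List.mem_append_right _ List.mem_cons_self : arrA B A a ∈ (pathB B A q).arrows)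

/-! ### The path algebra of `B` as a retract -/

theorem lift_pathB_mul (p q : B.Path) :
    lift (fun r => of k (pathB B A r)) (of k p * of k q) =
      of k (pathB B A p) * of k (pathB B A q) := by
  by_cases h : q.target = p.source
  · obtain ⟨i, j, l, hl⟩ := p
    obtain ⟨i', j', l', hl'⟩ := q
    obtain rfl : j' = i := h
    rw [of_mul_of_comp, lift_of]
    refine Eq.trans ?_ (of_mul_of_comp (k := k) (Q := (dualExt B A).toFinQuiver)
      (isPath_map_arrB.2 hl') (isPath_map_arrB.2 hl)).symm
    exact congrArg (of k) (FinQuiver.Path.ext rfl rfl List.map_append)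
  · rw [of_mul_of_ne h, map_zero]
    exact (of_mul_of_ne (Q := (dualExt B A).toFinQuiver) h).symm

variable (k B A) in
/-- The inclusion of the path algebra of `B` in that of the dual extension. -/
def inclB : PathAlg k B.toFinQuiver →ₐ[k] PathAlg k (dualExt B A).toFinQuiver :=
  algHomOfPaths (lift fun p => of k (pathB B A p))
    (by rw [one_def, map_sum]; exact Finset.sum_congr rfl fun i _ => lift_of _ _)
    fun p q => by rw [lift_pathB_mul, lift_of, lift_of]

theorem inclB_of (p : B.Path) : inclB k B A (of k p) = of k (pathB B A p) := lift_of _ _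

theorem coef_pathB_inclB (q : B.Path) (f : PathAlg k B.toFinQuiver) :
    coef (pathB B A q) (inclB k B A f) = coef q f := by
  have h : coef (pathB B A q) ∘ₗ (inclB k B A).toLinearMap = coef q := hom_ext fun p => by
    rw [LinearMap.comp_apply, AlgHom.toLinearMap_apply, inclB_of, coef_of, coef_of]
    simp only [pathB_injective.eq_iff]
  exact LinearMap.congr_fun h f

variable (k B A) in
/-- The projection of the path algebra of the dual extension onto that of `B`, as a linear map. -/
def resBLinear : PathAlg k (dualExt B A).toFinQuiver →ₗ[k] PathAlg k B.toFinQuiver :=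
  Finsupp.lcomapDomain (pathB B A) pathB_injective

theorem coef_resBLinear (q : B.Path) (f : PathAlg k (dualExt B A).toFinQuiver) :
    coef q (resBLinear k B A f) = coef (pathB B A q) f := rfl

theorem resBLinear_inclB (f : PathAlg k B.toFinQuiver) : resBLinear k B A (inclB k B A f) = f :=
  ext_coef fun q => by rw [coef_resBLinear, coef_pathB_inclB]

theorem resBLinear_eq_zero {S : Set (dualExt B A).Path} (hS : Disjoint S (Set.range (pathB B A)))
    {f : PathAlg k (dualExt B A).toFinQuiver} (hf : f ∈ spanOf k S) :
    resBLinear k B A f = 0 := by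
  refine ext_coef fun q => ?_
  rw [coef_resBLinear, map_zero]
  exact mem_spanOf_iff.1 hf _ fun hq => Set.disjoint_left.1 hS hq ⟨q, rfl⟩

theorem resBLinear_of_eq_zero {p : (dualExt B A).Path} (hp : p ∉ Set.range (pathB B A)) :
    resBLinear k B A (of k p) = 0 :=
  resBLinear_eq_zero (Set.disjoint_singleton_left.2 hp) (of_mem_spanOf rfl)

theorem resBLinear_of_mul_of (p q : (dualExt B A).Path) :
    resBLinear k B A (of k p * of k q) =
      resBLinear k B A (of k p) * resBLinear k B A (of k q) := by
  by_cases h : p ∈ Set.range (pathB B A) ∧ q ∈ Set.range (pathB B A)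
  · obtain ⟨⟨p, rfl⟩, ⟨q, rfl⟩⟩ := h
    simp only [← inclB_of, ← map_mul, resBLinear_inclB]
  · have h_mul : resBLinear k B A (of k p * of k q) = 0 := by
      refine resBLinear_eq_zero (Set.disjoint_left.2 ?_) (of_mul_of_mem_spanOf p q)
      rintro _ hr ⟨r, rfl⟩
      obtain ⟨l, m, -, hl, hm⟩ := List.map_eq_append_iff.1 hr
      exact h ⟨mem_range_pathB.2 ⟨m, hm.symm⟩, mem_range_pathB.2 ⟨l, hl.symm⟩⟩
    rw [h_mul]
    rcases not_and_or.1 h with hp | hq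
    · rw [resBLinear_of_eq_zero hp, zero_mul]
    · rw [resBLinear_of_eq_zero hq, mul_zero]

variable (k B A) in
/-- The projection of the path algebra of the dual extension onto that of `B` which kills the arrows
of `Aᵒᵖ`. -/
def resB : PathAlg k (dualExt B A).toFinQuiver →ₐ[k] PathAlg k B.toFinQuiver :=
  algHomOfPaths (resBLinear k B A) (by rw [← map_one (inclB k B A), resBLinear_inclB])
    resBLinear_of_mul_of

theorem coef_resB (q : B.Path) (f : PathAlg k (dualExt B A).toFinQuiver) :
    coef q (resB k B A f) = coef (pathB B A q) f := rfl

theorem resB_inclB (f : PathAlg k B.toFinQuiver) : resB k B A (inclB k B A f) = f :=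
  resBLinear_inclB f

theorem resB_eq_zero {S : Set (dualExt B A).Path} (hS : Disjoint S (Set.range (pathB B A)))
    {f : PathAlg k (dualExt B A).toFinQuiver} (hf : f ∈ spanOf k S) : resB k B A f = 0 :=
  resBLinear_eq_zero hS hf

theorem resB_of_pathB (p : B.Path) : resB k B A (of k (pathB B A p)) = of k p := by
  rw [← inclB_of, resB_inclB]

theorem trunc_inclB (f : PathAlg k B.toFinQuiver) :
    (dualExt B A).trunc k (inclB k B A f) = inclB k B A (B.trunc k f) := by
  have h : (dualExt B A).trunc k ∘ₗ (inclB k B A).toLinearMap =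
      (inclB k B A).toLinearMap ∘ₗ B.trunc k := by
    refine hom_ext fun p => ?_
    simp only [LinearMap.comp_apply, AlgHom.toLinearMap_apply, inclB_of, trunc_of, isBasic_pathB]
    split_ifs
    · rw [inclB_of]
    · rw [map_zero]
  exact LinearMap.congr_fun h f

theorem resB_trunc (f : PathAlg k (dualExt B A).toFinQuiver) :
    resB k B A ((dualExt B A).trunc k f) = B.trunc k (resB k B A f) :=
  ext_coef fun q => by simp only [coef_resB, coef_trunc, isBasic_pathB]

theorem resB_vertex (i : Fin n) :
    resB k B A (of k (Path.vertex (dualExt B A).toFinQuiver i)) =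
      of k (Path.vertex B.toFinQuiver i) :=
  resB_of_pathB (Path.vertex B.toFinQuiver i)

theorem resB_arrB (b : B.Arr) :
    resB k B A (of k (Path.arrow (dualExt B A).toFinQuiver (arrB B A b))) =
      of k (Path.arrow B.toFinQuiver b) :=
  resB_of_pathB (Path.arrow B.toFinQuiver b)

theorem resB_arrA (a : A.op.Arr) :
    resB k B A (of k (Path.arrow (dualExt B A).toFinQuiver (arrA B A a))) = 0 := by
  refine resBLinear_of_eq_zero fun h => ?_
  obtain ⟨l, hl⟩ := mem_range_pathB.1 h
  exact arrA_notMem_map_arrB a l (hl ▸ List.mem_singleton_self _)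

theorem inclB_arrow (b : B.Arr) :
    inclB k B A (of k (Path.arrow B.toFinQuiver b)) =
      of k (Path.arrow (dualExt B A).toFinQuiver (arrB B A b)) :=
  inclB_of _

/-! ### The projection of `Ker δ¹` -/

theorem projB_apply (x : (dualExt B A).Arr × (dualExt B A).Path →₀ k) (b : B.Arr) (q : B.Path) :
    projB k B A x (b, q) = x (arrB B A b, pathB B A q) := rfl

theorem val_projB (x : (dualExt B A).Arr × (dualExt B A).Path →₀ k) (b : B.Arr) :
    B.val k b (projB k B A x) = resB k B A ((dualExt B A).val k (arrB B A b) x) :=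
  ext_coef fun q => by rw [coef_resB, coef_val, coef_val, projB_apply]

theorem projB_mem_C1 {x : (dualExt B A).Arr × (dualExt B A).Path →₀ k}
    (hx : x ∈ (dualExt B A).C1 k) : projB k B A x ∈ B.C1 k :=
  (Finsupp.mem_supported' _ _).2 fun _ h =>
    (Finsupp.mem_supported' _ _).1 hx _ fun h' => h ⟨isBasic_pathB.1 h'.1, h'.2⟩

theorem resB_val_arrA (hA : A.IsDirected) (hB : B.IsDirected)
    {x : (dualExt B A).Arr × (dualExt B A).Path →₀ k} (hx : x ∈ (dualExt B A).C1 k)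
    (a : A.op.Arr) : resB k B A ((dualExt B A).val k (arrA B A a) x) = 0 := by
  refine resB_eq_zero (Set.disjoint_left.2 ?_) (mem_C1_iff_val.1 hx _)
  rintro _ ⟨-, hs, ht⟩ ⟨q, rfl⟩
  have h_le : q.source ≤ q.target := hB.le_of_isPath q.isPath
  exact (hA a).not_ge (hs.symm.trans_le (h_le.trans_eq ht))

theorem resB_subst (hA : A.IsDirected) (hB : B.IsDirected)
    {x : (dualExt B A).Arr × (dualExt B A).Path →₀ k} (hx : x ∈ (dualExt B A).C1 k)
    (f : PathAlg k (dualExt B A).toFinQuiver) :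
    resB k B A ((dualExt B A).subst k x f) = B.subst k (projB k B A x) (resB k B A f) := by
  have h : (resB k B A).toLinearMap ∘ₗ (dualExt B A).subst k x =
      B.subst k (projB k B A x) ∘ₗ (resB k B A).toLinearMap := by
    refine leibniz_hom_ext (resB k B A) (fun f g => ?_) (fun f g => ?_) (fun i => ?_) (fun c => ?_)
    all_goals simp only [LinearMap.comp_apply, AlgHom.toLinearMap_apply]
    · rw [subst_mul hx, map_add, map_mul, map_mul]
    · rw [map_mul, subst_mul (projB_mem_C1 hx)]
    · rw [resB_vertex, subst_vertex _ _ rfl, subst_vertex _ _ rfl, map_zero]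
    · rw [subst_arrow hx]
      rcases exists_arrB_or_arrA c with ⟨b, rfl⟩ | ⟨a, rfl⟩
      · rw [resB_arrB, subst_arrow (projB_mem_C1 hx), val_projB]
      · rw [resB_arrA, map_zero, resB_val_arrA hA hB hx]
  exact LinearMap.congr_fun h f

theorem projB_mem_kerDelta1 (hA : A.IsDirected) (hB : B.IsDirected)
    {x : (dualExt B A).Arr × (dualExt B A).Path →₀ k} (hx : x ∈ (dualExt B A).kerDelta1 k) :
    projB k B A x ∈ B.kerDelta1 k := by
  refine mem_kerDelta1_iff.2 ⟨projB_mem_C1 hx.1, fun r hr => ?_⟩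
  rw [← resB_of_pathB (A := A) r, ← resB_subst hA hB hx.1, ← resB_trunc,
    trunc_subst_rel hx (pathB_mem_rel hr), map_zero]

variable (k) in
/-- The projection `Ker δ¹_Λ → Ker δ¹_B`. -/
def projKer (hA : A.IsDirected) (hB : B.IsDirected) :
    (dualExt B A).kerDelta1 k →ₗ⁅k⁆ B.kerDelta1 k where
  toFun x := ⟨projB k B A x.1, projB_mem_kerDelta1 hA hB x.2⟩
  map_add' x y := Subtype.ext (map_add _ _ _)
  map_smul' c x := Subtype.ext (map_smul _ _ _)
  map_lie' := by
    intro x y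
    refine Subtype.ext (val_ext fun b => ?_)
    change B.val k b (projB k B A ((dualExt B A).br k x.1 y.1)) =
      B.val k b (B.br k (projB k B A x.1) (projB k B A y.1))
    rw [val_br, val_projB, val_br, map_sub, resB_trunc, resB_trunc, resB_subst hA hB x.2.1,
      resB_subst hA hB y.2.1, val_projB, val_projB]

/-! ### Elements of `Ker δ¹` concentrated on the arrows of `B` -/

theorem subst_of_congr {Q : MonomialQuiver.{u} n} {x y : Q.Arr × Q.Path →₀ k} (hx : x ∈ Q.C1 k)
    (hy : y ∈ Q.C1 k) {p : Q.Path} (h : ∀ a ∈ p.arrows, Q.val k a x = Q.val k a y) :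
    Q.subst k x (of k p) = Q.subst k y (of k p) := by
  obtain ⟨i, j, l, hl⟩ := p
  induction l generalizing i with
  | nil => rw [subst_vertex _ _ rfl, subst_vertex _ _ rfl]
  | cons a l ih =>
    rw [of_cons, subst_mul hx, subst_mul hy, subst_arrow hx, subst_arrow hy,
      h a List.mem_cons_self, ih _ _ fun c hc => h c (List.mem_cons_of_mem _ hc)]

theorem trunc_mul_arrA_eq_zero (hA : A.IsDirected) (hB : B.IsDirected) {b : B.Arr}
    {f : PathAlg k (dualExt B A).toFinQuiver}
    (hf : f ∈ spanOf k {p | IsBasic p ∧ p.source = B.src b ∧ p.target = B.tgt b})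
    (a : A.op.Arr) :
    (dualExt B A).trunc k
      (f * of k (Path.arrow (dualExt B A).toFinQuiver (arrA B A a))) = 0 := by
  let φ := (dualExt B A).trunc k ∘ₗ
    LinearMap.mulRight k (of k (Path.arrow (dualExt B A).toFinQuiver (arrA B A a)))
  have h : (spanOf k {p | IsBasic p ∧ p.source = B.src b ∧ p.target = B.tgt b}).map φ ≤ ⊥ := by
    refine map_spanOf_le fun p ⟨hp, hs, ht⟩ => (Submodule.mem_bot k).2 (ext_coef fun r => ?_)
    change coef r ((dualExt B A).trunc k (of k p * of k (Path.arrow _ (arrA B A a)))) = coef r 0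
    rw [coef_trunc, map_zero, ite_eq_right_iff]
    refine fun hr => mem_spanOf_iff.1 (of_mul_of_mem_spanOf _ _) r fun e => ?_
    obtain ⟨b', l, m, hlm⟩ := exists_eq_cons_append hA hB hp hs ht
    refine not_isBasic_of_arrA_arrB_infix (a := a) (b := b') ?_ hr
    rw [show r.arrows = _ from e, hlm]
    exact (List.prefix_append [_, _] _).isInfix
  exact (Submodule.mem_bot k).1 (h ⟨f, hf, rfl⟩)

theorem of_mixedRel (α : B.Arr) (β : A.op.Arr) (h : A.op.tgt β = B.src α) :
    (of k (mixedRel B.toFinQuiver A.op.toFinQuiver α β h) :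
      PathAlg k (dualExt B A).toFinQuiver) =
      of k (Path.arrow (dualExt B A).toFinQuiver (arrB B A α)) *
        of k (Path.arrow (dualExt B A).toFinQuiver (arrA B A β)) := by
  refine (of_cons (Q := (dualExt B A).toFinQuiver)
    (mixedRel B.toFinQuiver A.op.toFinQuiver α β h).isPath).trans ?_
  congr 2
  exact FinQuiver.Path.ext h rfl rfl

theorem mem_kerDelta1_of_val_arrA_eq_zero (hA : A.IsDirected) (hB : B.IsDirected)
    {x : (dualExt B A).Arr × (dualExt B A).Path →₀ k} (hx : x ∈ (dualExt B A).C1 k)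
    (h_arrA : ∀ a, (dualExt B A).val k (arrA B A a) x = 0)
    (h_rel : ∀ r ∈ B.rel,
      (dualExt B A).trunc k ((dualExt B A).subst k x (of k (pathB B A r))) = 0) :
    x ∈ (dualExt B A).kerDelta1 k := by
  refine mem_kerDelta1_iff.2 ⟨hx, ?_⟩
  rintro _ ((⟨r, hr, rfl⟩ | ⟨r, -, rfl⟩) | ⟨α, β, h, rfl⟩)
  · exact h_rel r hr
  · have h_subst : (dualExt B A).subst k x (of k (Path.inr B.toFinQuiver r)) =
        (dualExt B A).subst k 0 (of k (Path.inr B.toFinQuiver r)) := by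
      refine subst_of_congr hx (Submodule.zero_mem _) fun c hc => ?_
      obtain ⟨a, _, rfl⟩ := List.mem_map.1 hc
      exact (h_arrA a).trans (map_zero _).symm
    refine (congrArg ((dualExt B A).trunc k) h_subst).trans ?_
    rw [map_zero, LinearMap.zero_apply, map_zero]
  · refine (congrArg (fun f => (dualExt B A).trunc k ((dualExt B A).subst k x f))
      (of_mixedRel α β h)).trans ?_
    rw [subst_mul hx, subst_arrow hx, subst_arrow hx, h_arrA, mul_zero, add_zero]
    exact trunc_mul_arrA_eq_zero hA hB (mem_C1_iff_val.1 hx (arrB B A α)) β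

variable (k B A) in
/-- The inclusion of `k((Q_B)₁//ℬ_B)` in `k((Q_Λ)₁//ℬ_Λ)`, a section of `projB`. -/
def inclPairs : (B.Arr × B.Path →₀ k) →ₗ[k] ((dualExt B A).Arr × (dualExt B A).Path →₀ k) :=
  Finsupp.lmapDomain k k (Prod.map (arrB B A) (pathB B A))

theorem projB_inclPairs (y : B.Arr × B.Path →₀ k) : projB k B A (inclPairs k B A y) = y :=
  Finsupp.comapDomain_mapDomain _ (arrB_injective.prodMap pathB_injective) y

theorem inclPairs_single (b : B.Arr) (p : B.Path) :
    inclPairs k B A (Finsupp.single (b, p) 1) =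
      Finsupp.single (arrB B A b, pathB B A p) 1 := Finsupp.mapDomain_single

theorem val_inclPairs_arrB (y : B.Arr × B.Path →₀ k) (b : B.Arr) :
    (dualExt B A).val k (arrB B A b) (inclPairs k B A y) = inclB k B A (B.val k b y) := by
  have h : (dualExt B A).val k (arrB B A b) ∘ₗ inclPairs k B A =
      (inclB k B A).toLinearMap ∘ₗ B.val k b := by
    refine pairs_hom_ext fun c p => ?_
    simp only [LinearMap.comp_apply, AlgHom.toLinearMap_apply, inclPairs_single, val_single,
      arrB_injective.eq_iff]
    split_ifs
    · rw [inclB_of]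
    · rw [map_zero]
  exact LinearMap.congr_fun h y

theorem val_inclPairs_arrA (y : B.Arr × B.Path →₀ k) (a : A.op.Arr) :
    (dualExt B A).val k (arrA B A a) (inclPairs k B A y) = 0 := by
  have h : (dualExt B A).val k (arrA B A a) ∘ₗ inclPairs k B A = 0 := pairs_hom_ext fun c p => by
    rw [LinearMap.comp_apply, inclPairs_single, val_single, if_neg (arrA_ne_arrB a c).symm,
      LinearMap.zero_apply]
  exact LinearMap.congr_fun h y

theorem inclPairs_mem_C1 {y : B.Arr × B.Path →₀ k} (hy : y ∈ B.C1 k) :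
    inclPairs k B A y ∈ (dualExt B A).C1 k := by
  refine C1_induction (P := fun y => inclPairs k B A y ∈ (dualExt B A).C1 k)
    (by rw [map_zero]; exact Submodule.zero_mem _)
    (fun x y hx hy => by rw [map_add]; exact Submodule.add_mem _ hx hy)
    (fun c x hx => by rw [map_smul]; exact Submodule.smul_mem _ _ hx)
    (fun b p hp hs ht => ?_) hy
  rw [inclPairs_single]
  exact Finsupp.single_mem_supported k 1 ⟨isBasic_pathB.2 hp, hs, ht⟩

theorem subst_inclPairs {y : B.Arr × B.Path →₀ k} (hy : y ∈ B.C1 k)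
    (f : PathAlg k B.toFinQuiver) :
    (dualExt B A).subst k (inclPairs k B A y) (inclB k B A f) =
      inclB k B A (B.subst k y f) := by
  have h : (dualExt B A).subst k (inclPairs k B A y) ∘ₗ (inclB k B A).toLinearMap =
      (inclB k B A).toLinearMap ∘ₗ B.subst k y := by
    refine leibniz_hom_ext (inclB k B A) (fun f g => ?_) (fun f g => ?_) (fun i => ?_) (fun b => ?_)
    all_goals simp only [LinearMap.comp_apply, AlgHom.toLinearMap_apply]
    · rw [map_mul, subst_mul (inclPairs_mem_C1 hy)]
    · rw [subst_mul hy, map_add, map_mul, map_mul]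
    · rw [inclB_of, subst_vertex _ _ rfl, subst_vertex _ _ rfl, map_zero]
    · rw [inclB_arrow, subst_arrow hy, subst_arrow (inclPairs_mem_C1 hy), val_inclPairs_arrB]
  exact LinearMap.congr_fun h f

theorem inclPairs_mem_kerDelta1 (hA : A.IsDirected) (hB : B.IsDirected)
    {y : B.Arr × B.Path →₀ k} (hy : y ∈ B.kerDelta1 k) :
    inclPairs k B A y ∈ (dualExt B A).kerDelta1 k := by
  refine mem_kerDelta1_of_val_arrA_eq_zero hA hB (inclPairs_mem_C1 hy.1) (val_inclPairs_arrA y)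
    fun r hr => ?_
  rw [← inclB_of, subst_inclPairs hy.1, trunc_inclB, trunc_subst_rel hy hr, map_zero]

theorem projKer_surjective (hA : A.IsDirected) (hB : B.IsDirected) :
    Function.Surjective (projKer k hA hB) := fun y =>
  ⟨⟨inclPairs k B A y.1, inclPairs_mem_kerDelta1 hA hB y.2⟩, Subtype.ext (projB_inclPairs y.1)⟩

end MonomialQuiver

/-! ### The ideals `𝒥` and `ℐ` -/

namespace MonomialQuiver

open FinQuiver PathAlg

variable {n : ℕ} {k : Type*} [Field k] {B A : MonomialQuiver.{u} n}

theorem disjoint_idealJ'_kerRel : Disjoint (idealJ' k B A) (kerRel k B A) := by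
  refine Submodule.disjoint_def.2 fun x ⟨_, h_supp⟩ ⟨_, h_arrB⟩ => val_ext fun c => ?_
  rw [map_zero]
  rcases exists_arrB_or_arrA c with ⟨b, rfl⟩ | ⟨a, rfl⟩
  · exact (Submodule.mem_iInf _).1 h_arrB b
  · refine ext_coef fun p => ?_
    rw [coef_val, map_zero]
    exact (Finsupp.mem_supported' _ _).1 h_supp _ fun ⟨⟨b, hb⟩, _⟩ => arrA_ne_arrB a b hb

/-- The part of `x ∈ k((Q_Λ)₁//ℬ_Λ)` that lies in the span of the `b//p` with `b` an arrow of
`B`. -/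
def restrictB (x : (dualExt B A).Arr × (dualExt B A).Path →₀ k) :
    (dualExt B A).Arr × (dualExt B A).Path →₀ k :=
  x.filter fun cp => cp.1 ∈ Set.range (arrB B A)

theorem val_restrictB_arrB (x : (dualExt B A).Arr × (dualExt B A).Path →₀ k) (b : B.Arr) :
    (dualExt B A).val k (arrB B A b) (restrictB x) = (dualExt B A).val k (arrB B A b) x :=
  ext_coef fun p => by
    rw [coef_val, coef_val, restrictB, Finsupp.filter_apply, if_pos ⟨b, rfl⟩]

theorem val_restrictB_arrA (x : (dualExt B A).Arr × (dualExt B A).Path →₀ k) (a : A.op.Arr) :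
    (dualExt B A).val k (arrA B A a) (restrictB x) = 0 :=
  ext_coef fun p => by
    rw [coef_val, map_zero, restrictB, Finsupp.filter_apply,
      if_neg fun ⟨b, hb⟩ => arrA_ne_arrB a b hb.symm]

theorem restrictB_mem_C1 {x : (dualExt B A).Arr × (dualExt B A).Path →₀ k}
    (hx : x ∈ (dualExt B A).C1 k) : restrictB x ∈ (dualExt B A).C1 k :=
  (Finsupp.mem_supported' _ _).2 fun cp hcp => by
    rw [restrictB, Finsupp.filter_apply, (Finsupp.mem_supported' _ _).1 hx cp hcp, ite_self]

theorem restrictB_mem_kerDelta1 (hA : A.IsDirected) (hB : B.IsDirected)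
    {x : (dualExt B A).Arr × (dualExt B A).Path →₀ k} (hx : x ∈ (dualExt B A).kerDelta1 k) :
    restrictB x ∈ (dualExt B A).kerDelta1 k := by
  have hx' := restrictB_mem_C1 hx.1
  refine mem_kerDelta1_of_val_arrA_eq_zero hA hB hx' (val_restrictB_arrA x) fun r hr => ?_
  have h_subst : (dualExt B A).subst k (restrictB x) (of k (pathB B A r)) =
      (dualExt B A).subst k x (of k (pathB B A r)) := by
    refine subst_of_congr hx' hx.1 fun c hc => ?_
    obtain ⟨b, _, rfl⟩ := List.mem_map.1 hc
    exact val_restrictB_arrB x b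
  rw [h_subst, trunc_subst_rel hx (pathB_mem_rel hr)]

theorem restrictB_mem_idealJ' (hA : A.IsDirected) (hB : B.IsDirected)
    {x : (dualExt B A).Arr × (dualExt B A).Path →₀ k} (hx : x ∈ (dualExt B A).kerDelta1 k)
    (h : projB k B A x = 0) : restrictB x ∈ idealJ' k B A := by
  refine ⟨restrictB_mem_kerDelta1 hA hB hx, (Finsupp.mem_supported _ _).2 fun ⟨c, p⟩ hcp => ?_⟩
  obtain ⟨h_ne, ⟨b, rfl⟩⟩ := Finset.mem_filter.1 hcp
  obtain ⟨hp, hs, ht⟩ := (Finsupp.mem_supported k x).1 hx.1 h_ne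
  refine ⟨⟨b, rfl⟩, hp, isMixed_of_notMem_range_pathB hA hB hp hs ht ?_⟩
  rintro ⟨q, rfl⟩
  exact Finsupp.mem_support_iff.1 h_ne (DFunLike.congr_fun h (b, q))

theorem sub_restrictB_mem_kerRel (hA : A.IsDirected) (hB : B.IsDirected)
    {x : (dualExt B A).Arr × (dualExt B A).Path →₀ k} (hx : x ∈ (dualExt B A).kerDelta1 k) :
    x - restrictB x ∈ kerRel k B A :=
  ⟨Submodule.sub_mem _ hx (restrictB_mem_kerDelta1 hA hB hx), (Submodule.mem_iInf _).2 fun b =>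
    LinearMap.mem_ker.2 (by rw [map_sub, val_restrictB_arrB, sub_self])⟩

theorem projB_eq_zero_of_mem_idealJ' {x : (dualExt B A).Arr × (dualExt B A).Path →₀ k}
    (hx : x ∈ idealJ' k B A) : projB k B A x = 0 := by
  ext ⟨b, q⟩
  exact (Finsupp.mem_supported' _ _).1 hx.2 _ fun ⟨_, _, hq⟩ => hq.notMem_range_pathB ⟨q, rfl⟩

theorem projB_eq_zero_of_mem_kerRel {x : (dualExt B A).Arr × (dualExt B A).Path →₀ k}
    (hx : x ∈ kerRel k B A) : projB k B A x = 0 :=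
  val_ext fun b => by
    rw [val_projB, LinearMap.mem_ker.1 ((Submodule.mem_iInf _).1 hx.2 b), map_zero, map_zero]

theorem mem_idealJ_iff (hA : A.IsDirected) (hB : B.IsDirected)
    {x : (dualExt B A).Arr × (dualExt B A).Path →₀ k} (hx : x ∈ (dualExt B A).kerDelta1 k) :
    x ∈ idealJ k B A ↔ projB k B A x = 0 := by
  constructor
  · intro h
    have h_le : idealJ k B A ≤ LinearMap.ker (projB k B A) :=
      sup_le (fun _ => projB_eq_zero_of_mem_idealJ') fun _ => projB_eq_zero_of_mem_kerRel
    exact h_le h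
  · intro h
    rw [← add_sub_cancel (restrictB x) x]
    exact Submodule.add_mem_sup (restrictB_mem_idealJ' hA hB hx h)
      (sub_restrictB_mem_kerRel hA hB hx)

theorem projB_arrowCommutators (f : PathAlg k (dualExt B A).toFinQuiver) :
    projB k B A ((dualExt B A).arrowCommutators k f) = B.arrowCommutators k (resB k B A f) :=
  val_ext fun b => by
    rw [val_projB, val_arrowCommutators, val_arrowCommutators, resB_trunc, map_sub, map_mul,
      map_mul, resB_arrB]

theorem resB_mem_spanOf_cyclicBasic {f : PathAlg k (dualExt B A).toFinQuiver}
    (hf : f ∈ spanOf k (dualExt B A).cyclicBasic) : resB k B A f ∈ spanOf k B.cyclicBasic :=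
  mem_spanOf_iff.2 fun q hq => mem_spanOf_iff.1 hf (pathB B A q) fun ⟨hb, hc⟩ =>
    hq ⟨isBasic_pathB.1 hb, hc⟩

theorem inclB_mem_spanOf_cyclicBasic {f : PathAlg k B.toFinQuiver}
    (hf : f ∈ spanOf k B.cyclicBasic) : inclB k B A f ∈ spanOf k (dualExt B A).cyclicBasic := by
  have h_le : (spanOf k B.cyclicBasic).map (inclB k B A).toLinearMap ≤
      spanOf k (dualExt B A).cyclicBasic := by
    refine map_spanOf_le fun q hq => ?_
    rw [AlgHom.toLinearMap_apply, inclB_of]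
    exact of_mem_spanOf ⟨isBasic_pathB.2 hq.1, hq.2⟩
  exact h_le ⟨f, hf, rfl⟩

theorem map_projB_imDelta0 : ((dualExt B A).imDelta0 k).map (projB k B A) = B.imDelta0 k := by
  rw [imDelta0_eq_map, imDelta0_eq_map]
  refine le_antisymm ?_ ?_
  · rintro _ ⟨_, ⟨f, hf, rfl⟩, rfl⟩
    exact ⟨resB k B A f, resB_mem_spanOf_cyclicBasic hf, (projB_arrowCommutators f).symm⟩
  · rintro _ ⟨f, hf, rfl⟩
    refine ⟨_, ⟨inclB k B A f, inclB_mem_spanOf_cyclicBasic hf, rfl⟩, ?_⟩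
    rw [projB_arrowCommutators, resB_inclB]

theorem projB_arrowCommutators_eq_zero_iff (hB : B.IsDirected)
    {f : PathAlg k (dualExt B A).toFinQuiver} (hf : f ∈ spanOf k (dualExt B A).cyclicBasic) :
    projB k B A ((dualExt B A).arrowCommutators k f) = 0 ↔
      ∀ b : B.Arr, coef (Path.vertex (dualExt B A).toFinQuiver (B.src b)) f =
        coef (Path.vertex (dualExt B A).toFinQuiver (B.tgt b)) f := by
  rw [projB_arrowCommutators, arrowCommutators_eq_zero_iff hB (resB_mem_spanOf_cyclicBasic hf)]
  exact Iff.rfl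

theorem projB_eq_zero_of_mem_idealI (hB : B.IsDirected)
    {z : (dualExt B A).Arr × (dualExt B A).Path →₀ k} (hz : z ∈ idealI k B A) :
    projB k B A z = 0 := by
  obtain ⟨h_im, h_deg⟩ := hz
  rw [imDelta0_eq_map] at h_im
  obtain ⟨f, hf, rfl⟩ := h_im
  exact (projB_arrowCommutators_eq_zero_iff hB hf).2 fun b =>
    arrowCommutators_mem_supported_iff.1 h_deg (arrB B A b)

theorem idealI_le_idealJ (hA : A.IsDirected) (hB : B.IsDirected) :
    idealI k B A ≤ idealJ k B A := fun _ hz =>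
  (mem_idealJ_iff hA hB (imDelta0_le_kerDelta1 hz.1)).2 (projB_eq_zero_of_mem_idealI hB hz)

theorem mem_idealI_iff (hB : B.IsDirected) (hconn : ∀ a : A.Arr, B.Linked (A.src a) (A.tgt a))
    {z : (dualExt B A).Arr × (dualExt B A).Path →₀ k} (hz : z ∈ (dualExt B A).imDelta0 k) :
    z ∈ idealI k B A ↔ projB k B A z = 0 := by
  refine ⟨projB_eq_zero_of_mem_idealI hB, fun h => ⟨hz, ?_⟩⟩
  rw [imDelta0_eq_map] at hz
  obtain ⟨f, hf, rfl⟩ := hz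
  have h_const := (projB_arrowCommutators_eq_zero_iff hB hf).1 h
  refine arrowCommutators_mem_supported_iff.2 fun c => ?_
  rcases exists_arrB_or_arrA c with ⟨b, rfl⟩ | ⟨a, rfl⟩
  · exact h_const b
  · exact (eq_of_linked (f := fun i => coef (Path.vertex (dualExt B A).toFinQuiver i) f) h_const
      (hconn a)).symm

theorem mem_ker_projKer_iff (hA : A.IsDirected) (hB : B.IsDirected)
    (x : (dualExt B A).kerDelta1 k) : x ∈ (projKer k hA hB).ker ↔ x.1 ∈ idealJ k B A := by
  rw [LieHom.mem_ker, mem_idealJ_iff hA hB x.2]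
  exact Subtype.ext_iff

theorem mem_ker_toHH1_comp_incl_iff (hA : A.IsDirected) (hB : B.IsDirected)
    (hconn : ∀ a : A.Arr, B.Linked (A.src a) (A.tgt a)) (x : (projKer k hA hB).ker) :
    x ∈ (((dualExt B A).toHH1 k).comp (projKer k hA hB).ker.incl).ker ↔
      x.1.1 ∈ idealI k B A := by
  refine LieHom.mem_ker.trans ((toHH1_eq_zero_iff x.1).trans ⟨fun h => ?_, fun h => h.1⟩)
  exact (mem_idealI_iff hB hconn h).2 (Subtype.ext_iff.1 (LieHom.mem_ker.1 x.2))

theorem toHH1_eq_zero_iff_exists_projKer_eq (hA : A.IsDirected) (hB : B.IsDirected)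
    (y : B.kerDelta1 k) :
    B.toHH1 k y = 0 ↔ ∃ x, (dualExt B A).toHH1 k x = 0 ∧ projKer k hA hB x = y := by
  rw [toHH1_eq_zero_iff, ← map_projB_imDelta0 (A := A)]
  constructor
  · rintro ⟨z, hz, hzy⟩
    exact ⟨⟨z, imDelta0_le_kerDelta1 hz⟩, (toHH1_eq_zero_iff _).2 hz, Subtype.ext hzy⟩
  · rintro ⟨x, hx, rfl⟩
    exact ⟨x.1, (toHH1_eq_zero_iff _).1 hx, rfl⟩

end MonomialQuiver

end

open MonomialQuiver in
theorem mainTheorem5 {k : Type*} [Field k] {n : ℕ} (A B : MonomialQuiver n)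
    (hA : A.IsDirected) (hB : B.IsDirected)
    (hconn : ∀ a : A.Arr, B.Linked (A.src a) (A.tgt a)) :
    Disjoint (idealJ' k B A) (kerRel k B A) ∧
    idealI k B A ≤ idealJ k B A ∧
    ∃ (J : LieIdeal k ((dualExt B A).kerDelta1 k)) (I : LieIdeal k J),
      (∀ x : (dualExt B A).kerDelta1 k, x ∈ J ↔ x.1 ∈ idealJ k B A) ∧
      (∀ x : J, x ∈ I ↔ x.1.1 ∈ idealI k B A) ∧
      ∃ (f : (J ⧸ I) →ₗ⁅k⁆ HH1 k ((dualExt B A).Alg k))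
        (g : HH1 k ((dualExt B A).Alg k) →ₗ⁅k⁆ HH1 k (B.Alg k)),
        Function.Injective f ∧ Function.Exact f g ∧ Function.Surjective g ∧
        -- `f` is induced by the inclusion of `J` in `Ker δ¹`
        (∀ x : J, ∃ D : algDer k ((dualExt B A).Alg k), Represents k x.1.1 D ∧
          f (LieSubmodule.Quotient.mk x) = LieSubmodule.Quotient.mk D) ∧
        -- `g` is induced by the projection of `Ker δ¹_Λ` onto `Ker δ¹_B`
        (∀ x : (dualExt B A).kerDelta1 k,
          projB k B A x.1 ∈ B.kerDelta1 k ∧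
          ∃ (D : algDer k ((dualExt B A).Alg k)) (D' : algDer k (B.Alg k)),
            Represents k x.1 D ∧ Represents k (projB k B A x.1) D' ∧
            g (LieSubmodule.Quotient.mk D) = LieSubmodule.Quotient.mk D') := by
  obtain ⟨f, g, hf_inj, h_exact, hg_surj, hf, hg⟩ :=
    exists_exact_quotient_ker (projKer_surjective hA hB) toHH1_surjective toHH1_surjective
      (toHH1_eq_zero_iff_exists_projKer_eq (k := k) hA hB)
  exact ⟨disjoint_idealJ'_kerRel, idealI_le_idealJ hA hB, (projKer k hA hB).ker,
    (((dualExt B A).toHH1 k).comp (projKer k hA hB).ker.incl).ker, mem_ker_projKer_iff hA hB,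
    mem_ker_toHH1_comp_incl_iff hA hB hconn, f, g, hf_inj, h_exact, hg_surj,
    fun x => ⟨(dualExt B A).derOf k x.1, represents_derOf x.1, hf x⟩,
    fun x => ⟨projB_mem_kerDelta1 hA hB x.2, (dualExt B A).derOf k x,
      B.derOf k (projKer k hA hB x), represents_derOf x, represents_derOf (projKer k hA hB x),
      hg x⟩⟩
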